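/- A vehicle-manipulator system consists of a rigid moving base and a serial chain of $n$ rigid links with one-degree-of-freedom (revolute or prismatic) joints. The configuration group $G_b$ of the base is $SE(3)$ (floating base, $b=6$) or the copy of $SE(2)$ in $SE(3)$ (planar base, $b=3$), with Lie algebra $\mathfrak g_b\cong\mathbb R^b$ and inclusion matrix $S_b\in\mathbb R^{6\times b}$ into $se(3)\cong\mathbb R^6$; the configuration space of the manipulator is $Q_m=G_1\times\cdots\times G_n$, where $G_i=\mathbb S^1$ for a revolute and $G_i=\mathbb R$ for a prismatic joint. Link $i$ has relative pose $H_i^{i-1}(q_i)=H_i^{i-1}(0)\exp(q_i\tilde S_i)$ with unit joint twist $S_i$, and $H_i^b(q)=H_1^0(q_1)\cdots H_i^{i-1}(q_i)$, $H_b^i=(H_i^b)^{-1}$, $H_j^i=H_b^iH_j^b$. The generalized inertia matrices $\mathcal I_b,\mathcal I_1,\dots,\mathcal I_n\in\mathbb R^{6\times6}$ of the bodies are symmetric positive definite. Let $J_i(q)\in\mathbb R^{6\times n}$ have columns $\mathrm{Ad}_{H_j^i(q)}S_j$ for $j\le i$ and $0$ for $j>i$, and let $$M=\begin{pmatrix}M_b&M_{bm}\\M_{bm}^\top&M_m\end{pmatrix},\quad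 M_b=S_b^\top\Big[\mathcal I_b+\sum_i \mathrm{Ad}_{H_b^i}^\top \mathcal I_i\mathrm{Ad}_{H_b^i}\Big]S_b,\quad M_{bm}=\sum_i S_b^\top\mathrm{Ad}_{H_b^i}^\top\mathcal I_iJ_i,\quad M_m=\sum_iJ_i^\top\mathcal I_iJ_i .$$ Let $L(v,q,\dot q)=\frac12(v,\dot q)^\top M(q)(v,\dot q)$ be the reduced kinetic Lagrangian on $\mathfrak g_b\times TQ_m$, corresponding to the left-invariant Lagrangian on $T(G_b\times Q_m)$ with $v=h^{-1}\dot h$. Then: (1) $M(q)$ is positive definite for every $q$. The conjugate momenta are $p=\partial L/\partial v=M_bv+M_{bm}\dot q$ and $\pi=\partial L/\partial\dot q=M_{bm}^\top v+M_m\dot q$; for every $q$ the map $(v,\dot q)\mapsto(p,\pi)$ is bijective, and the Legendre transform $\langle p,v\rangle+\langle\pi,\dot q\rangle-L$ of $L$ is the smooth function $$H(p,q,\pi)=\tfrac12\begin{pmatrix}p\\\pi\end{pmatrix}^\top M(q)^{-1}\begin{pmatrix}p\\\pi\end{pmatrix}$$ on the state space $X=\mathfrak g_b^*\times T^*Q_m$.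 (2) Define $ad_p^\sim:\mathfrak g_b\to\mathfrak g_b^*$ by $ad_p^\sim v=ad_v^\top p$, and $$\mathcal J(p)=\begin{pmatrix}ad_p^\sim&0&0\\0&0&I_n\\0&-I_n&0\end{pmatrix},\qquad \mathcal G=\begin{pmatrix}I_b&0\\0&0\\0&I_n\end{pmatrix}.$$ Here $I_b$ and $I_n$ in $\mathcal J,\mathcal G$ are identity matrices. Then $\mathcal J(p)$ is skew-symmetric. Let $a<b$, let $(h,q)$ be a $C^2$ motion in $G_b\times Q_m$, let $v=h^{-1}\dot h$, let $w:[a,b]\to\mathfrak g_b^*$ (the resultant wrench on the base, in the base frame) and $\tau:[a,b]\to\mathbb R^n$ (the resultant joint torques) be continuous, and let $p$ and $\pi$ be curves in $\mathfrak g_b^*$ and $\mathbb R^n$. The following are equivalent: (i) $(h,q)$ satisfies on $[a,b]$ the Lagrange–d'Alembert principle for the left-invariant Lagrangian, $\delta\int_a^bL\,dt+\int_a^b(\langle w,h^{-1}\delta h\rangle+\langle\tau,\delta q\rangle)\,dt=0$ for all variations with fixed end points, and $p,\pi$ are the conjugate momenta along the motion on $[a,b]$; (ii) $(v,q,\dot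 q)$ satisfies on $[a,b]$ the reduced principle $\delta\int_a^bL(v,q,\dot q)\,dt+\int_a^b(\langle w,\eta\rangle+\langle\tau,\delta q\rangle)\,dt=0$ for all variations $\delta v=\dot\eta+ad_v\eta$ and $\delta q$ with $\eta,\delta q$ vanishing at the end points, and $p,\pi$ are the conjugate momenta along the motion on $[a,b]$; (iii) the port-Hamiltonian equations hold on $[a,b]$: $$\begin{pmatrix}\dot p\\\dot q\\\dot\pi\end{pmatrix}=\mathcal J(p)\begin{pmatrix}\partial H/\partial p\\\partial H/\partial q\\\partial H/\partial\pi\end{pmatrix}+\mathcal G\begin{pmatrix}w\\\tau\end{pmatrix},\qquad\begin{pmatrix}v\\\dot q\end{pmatrix}=\mathcal G^\top\begin{pmatrix}\partial H/\partial p\\\partial H/\partial q\\\partial H/\partial\pi\end{pmatrix}.$$ -/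

import Mathlib

open scoped Matrix

noncomputable section

namespace VehicleManipulator

/-! ### Rigid-body kinematics on `SE(3)` -/

/-- Index set of twists and wrenches: angular part first, linear part second. -/
abbrev Six : Type := Fin 3 ⊕ Fin 3

/-- Index set of homogeneous `4 × 4` matrices. -/
abbrev Hom : Type := Fin 3 ⊕ Fin 1

/-- The skew-symmetric matrix `ω̃` with `ω̃ x = ω × x`. -/
def skew (ω : Fin 3 → ℝ) : Matrix (Fin 3) (Fin 3) ℝ :=
  !![0, -ω 2, ω 1; ω 2, 0, -ω 0; -ω 1, ω 0, 0]

theorem skew_mulVec (ω x : Fin 3 → ℝ) : skew ω *ᵥ x = crossProduct ω x := by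
  ext i
  fin_cases i <;> simp [skew, Matrix.mulVec, dotProduct, Fin.sum_univ_three, cross_apply] <;> ring

/-- `SE(3)` as a set of homogeneous transformation matrices `(R, ξ; 0, 1)`, `R ∈ SO(3)`. -/
def SE3 : Set (Matrix Hom Hom ℝ) :=
  {H | ∃ R ∈ Matrix.specialOrthogonalGroup (Fin 3) ℝ, ∃ ξ : Fin 3 → ℝ,
    H = Matrix.fromBlocks R (Matrix.of fun i _ => ξ i) 0 1}

/-- The matrix in `se(3)` of a twist vector `(ω, v)`. -/
def hat (V : Six → ℝ) : Matrix Hom Hom ℝ :=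
  Matrix.fromBlocks (skew fun i => V (Sum.inl i)) (Matrix.of fun i _ => V (Sum.inr i)) 0 0

/-- The twist vector of a matrix in `se(3)`; the inverse of `hat`. -/
def vee (A : Matrix Hom Hom ℝ) : Six → ℝ :=
  Sum.elim
    ![A (Sum.inl 2) (Sum.inl 1), A (Sum.inl 0) (Sum.inl 2), A (Sum.inl 1) (Sum.inl 0)]
    (fun i => A (Sum.inl i) (Sum.inr 0))

theorem vee_hat (V : Six → ℝ) : vee (hat V) = V := by
  ext i
  rcases i with i | i <;> fin_cases i <;> simp [vee, hat, skew]

/-- `Ad_H` for `H = (R, ξ; 0, 1)`. -/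
def Ad (H : Matrix Hom Hom ℝ) : Matrix Six Six ℝ :=
  Matrix.fromBlocks H.toBlocks₁₁ 0 (skew (fun i => H (Sum.inl i) (Sum.inr 0)) * H.toBlocks₁₁)
    H.toBlocks₁₁

/-- `ad_V` for `V = (ω, v)`. -/
def ad (V : Six → ℝ) : Matrix Six Six ℝ :=
  Matrix.fromBlocks (skew fun i => V (Sum.inl i)) 0 (skew fun i => V (Sum.inr i))
    (skew fun i => V (Sum.inl i))

/-! ### The moving base -/

/-- The base moves freely in space (6 degrees of freedom) or in a plane (3 degrees of freedom). -/
inductive BaseKind : Type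
  | floating
  | planar

/-- Index set of coordinates on the Lie algebra `𝔤_b` (and on its dual):
`(ω, v)` for a floating base, `(ω, v_x, v_y)` for a planar one. -/
def BaseKind.Idx : BaseKind → Type
  | .floating => Six
  | .planar => Fin 3

instance BaseKind.instFintypeIdx : (k : BaseKind) → Fintype k.Idx
  | .floating => inferInstanceAs (Fintype Six)
  | .planar => inferInstanceAs (Fintype (Fin 3))

instance BaseKind.instDecidableEqIdx : (k : BaseKind) → DecidableEq k.Idx
  | .floating => inferInstanceAs (DecidableEq Six)
  | .planar => inferInstanceAs (DecidableEq (Fin 3))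

/-- Pose of a planar base with heading `θ` and position `(x, y)`. -/
def planarPose (θ x y : ℝ) : Matrix Hom Hom ℝ :=
  Matrix.fromBlocks
    !![Real.cos θ, -Real.sin θ, 0; Real.sin θ, Real.cos θ, 0; 0, 0, 1]
    (Matrix.of fun i _ => ![x, y, 0] i) 0 1

/-- The configuration group `G_b` of the base, identified with the group of its poses:
`SE(3)`, respectively the copy of `SE(2)` in `SE(3)`. -/
def BaseKind.group : BaseKind → Set (Matrix Hom Hom ℝ)
  | .floating => SE3
  | .planar => {H | ∃ θ x y : ℝ, H = planarPose θ x y}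

/-- The twist `(0, 0, ω, v_x, v_y, 0)` of a planar base as a function of `(ω, v_x, v_y)`. -/
def planarIncl : Matrix Six (Fin 3) ℝ :=
  Matrix.fromRows !![0, 0, 0; 0, 0, 0; 1, 0, 0] !![0, 1, 0; 0, 0, 1; 0, 0, 0]

/-- The matrix `S_b` of the inclusion `𝔤_b → se(3)`. -/
def BaseKind.incl : (k : BaseKind) → Matrix Six k.Idx ℝ
  | .floating => (1 : Matrix Six Six ℝ)
  | .planar => planarIncl

/-- `S_bᵀ` is a left inverse of `S_b`. -/
theorem BaseKind.incl_transpose_mul (k : BaseKind) : k.inclᵀ * k.incl = 1 := by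
  cases k
  · exact (by simp : (1 : Matrix Six Six ℝ)ᵀ * 1 = 1)
  · change planarInclᵀ * planarIncl = 1
    ext i j
    fin_cases i <;> fin_cases j <;>
      simp [planarIncl, Matrix.mul_apply, Fin.sum_univ_three]

/-- The matrix of `ad_v : 𝔤_b → 𝔤_b`: the bracket of `se(3)` restricted to `𝔤_b`. -/
def BaseKind.ad (k : BaseKind) (v : k.Idx → ℝ) : Matrix k.Idx k.Idx ℝ :=
  k.inclᵀ * VehicleManipulator.ad (k.incl *ᵥ v) * k.incl

/-- `𝔤_b` is closed under the bracket of `se(3)`, and `k.ad` is the restricted bracket. -/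
theorem BaseKind.incl_ad (k : BaseKind) (v η : k.Idx → ℝ) :
    k.incl *ᵥ (k.ad v *ᵥ η) = VehicleManipulator.ad (k.incl *ᵥ v) *ᵥ (k.incl *ᵥ η) := by
  cases k
  · change Six → ℝ at v η
    change (1 : Matrix Six Six ℝ) *ᵥ ((((1 : Matrix Six Six ℝ)ᵀ *
      VehicleManipulator.ad ((1 : Matrix Six Six ℝ) *ᵥ v) * (1 : Matrix Six Six ℝ)) :
        Matrix Six Six ℝ) *ᵥ η) =
        VehicleManipulator.ad ((1 : Matrix Six Six ℝ) *ᵥ v) *ᵥ ((1 : Matrix Six Six ℝ) *ᵥ η)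
    simp only [Matrix.transpose_one, Matrix.one_mulVec, Matrix.one_mul, Matrix.mul_one]
  · change Fin 3 → ℝ at v η
    change planarIncl *ᵥ ((planarInclᵀ * VehicleManipulator.ad (planarIncl *ᵥ v) * planarIncl) *ᵥ η)
      = VehicleManipulator.ad (planarIncl *ᵥ v) *ᵥ (planarIncl *ᵥ η)
    have hS : ∀ x : Fin 3 → ℝ, planarIncl *ᵥ x = Sum.elim ![0, 0, x 0] ![x 1, x 2, 0] := by
      intro x
      ext i
      rcases i with i | i <;> fin_cases i <;>
        simp [planarIncl, Matrix.mulVec, dotProduct, Fin.sum_univ_three]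
    have hT : ∀ y : Six → ℝ, planarInclᵀ *ᵥ y =
        ![y (Sum.inl 2), y (Sum.inr 0), y (Sum.inr 1)] := by
      intro y
      ext i
      fin_cases i <;> simp [planarIncl, Matrix.mulVec, dotProduct, Fin.sum_univ_three]
    have hA : ∀ V W : Six → ℝ, VehicleManipulator.ad V *ᵥ W = Sum.elim
        (crossProduct (fun i => V (Sum.inl i)) fun i => W (Sum.inl i))
        ((crossProduct (fun i => V (Sum.inr i)) fun i => W (Sum.inl i)) +
          crossProduct (fun i => V (Sum.inl i)) fun i => W (Sum.inr i)) := by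
      intro V W
      simp only [← skew_mulVec, VehicleManipulator.ad, Matrix.fromBlocks_mulVec,
        Matrix.zero_mulVec, add_zero]
      rfl
    rw [← Matrix.mulVec_mulVec, ← Matrix.mulVec_mulVec, hT, hS, hS, hS, hA]
    ext i
    rcases i with i | i <;> fin_cases i <;> simp [cross_apply]

/-- The operator `ad_p^∼ : 𝔤_b → 𝔤_b*` as a matrix; its columns are `ad_{e_j}ᵀ p`. -/
def BaseKind.adTilde (k : BaseKind) (p : k.Idx → ℝ) : Matrix k.Idx k.Idx ℝ :=
  Matrix.of fun i j => ((k.ad (Pi.single j 1))ᵀ *ᵥ p) i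

/-- The defining property `ad_p^∼ v = ad_vᵀ p`. -/
theorem BaseKind.adTilde_mulVec (k : BaseKind) (p v : k.Idx → ℝ) :
    k.adTilde p *ᵥ v = (k.ad v)ᵀ *ᵥ p := by
  have had : ∀ (c : ℝ) (V W : Six → ℝ), VehicleManipulator.ad (c • V + W) =
      c • VehicleManipulator.ad V + VehicleManipulator.ad W := by
    intro c V W
    have hs : ∀ x y : Fin 3 → ℝ, skew (fun i => c * x i + y i) = c • skew x + skew y := by
      intro x y
      ext i j
      fin_cases i <;> fin_cases j <;> simp [skew] <;> ring
    simp [VehicleManipulator.ad, hs, Matrix.fromBlocks_smul, Matrix.fromBlocks_add]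
  let f : (k.Idx → ℝ) →ₗ[ℝ] (k.Idx → ℝ) :=
    { toFun := fun v => (k.ad v)ᵀ *ᵥ p
      map_add' := by
        intro x y
        have := had 1 (k.incl *ᵥ x) (k.incl *ᵥ y)
        simp only [one_smul] at this
        simp [BaseKind.ad, Matrix.mulVec_add, this, Matrix.mul_add, Matrix.add_mul,
          Matrix.add_mulVec]
      map_smul' := by
        intro c x
        have := had c (k.incl *ᵥ x) 0
        have h0 : VehicleManipulator.ad (0 : Six → ℝ) = 0 := by simpa using had 1 0 0
        simp only [add_zero, h0] at this
        simp [BaseKind.ad, Matrix.mulVec_smul, this, Matrix.smul_mulVec] }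
  have hf : k.adTilde p = LinearMap.toMatrix' f := by
    ext i j
    simp [BaseKind.adTilde, LinearMap.toMatrix'_apply, f]
  rw [hf, ← Matrix.toLin'_apply, Matrix.toLin'_toMatrix']
  rfl

/-- The body velocity `v ∈ 𝔤_b` of a tangent vector `H'` to `G_b` at `H`, i.e.
`H⁻¹ H'` read as an element of `𝔤_b`. -/
def BaseKind.bodyVelocity (k : BaseKind) (H H' : Matrix Hom Hom ℝ) : k.Idx → ℝ :=
  k.inclᵀ *ᵥ vee (H⁻¹ * H')

/-- The entrywise derivative of a matrix-valued curve. -/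
def matDeriv (h : ℝ → Matrix Hom Hom ℝ) (t : ℝ) : Matrix Hom Hom ℝ :=
  Matrix.of fun i j => deriv (fun s => h s i j) t

/-! ### Joints -/

inductive JointKind : Type
  | revolute
  | prismatic

/-- The configuration group of a joint: the circle `ℝ/2πℤ` or the line. -/
def JointKind.Config : JointKind → Type
  | .revolute => Real.Angle
  | .prismatic => ℝ

instance JointKind.instAddCommGroup : (k : JointKind) → AddCommGroup k.Config
  | .revolute => inferInstanceAs (AddCommGroup Real.Angle)
  | .prismatic => inferInstanceAs (AddCommGroup ℝ)

/-- The covering homomorphism from the line to the configuration group of the joint. -/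
def JointKind.proj : (k : JointKind) → ℝ → k.Config
  | .revolute => fun x => (x : Real.Angle)
  | .prismatic => fun x => x

/-- A real coordinate of a joint configuration (for an angle, the one in `(-π, π]`). -/
def JointKind.coord : (k : JointKind) → k.Config → ℝ
  | .revolute => fun θ => Real.Angle.toReal θ
  | .prismatic => fun x => x

/-- A joint with one degree of freedom: its kind, its unit axis, a point on the axis (which is
used for revolute joints only) and the relative pose of the two bodies in the zero configuration. -/
structure Joint : Type where
  kind : JointKind
  axis : Fin 3 → ℝ
  axis_unit : axis ⬝ᵥ axis = 1
  point : Fin 3 → ℝ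
  home : Matrix Hom Hom ℝ
  home_mem : home ∈ SE3

/-- The unit twist of the joint. -/
def Joint.twist (j : Joint) : Six → ℝ :=
  match j.kind with
  | .revolute => Sum.elim j.axis (crossProduct j.point j.axis)
  | .prismatic => Sum.elim 0 j.axis

/-- The relative pose `H(0) exp(q Ŝ)` allowed by the joint. For a revolute joint `exp(q Ŝ)` is
`2π`-periodic in `q`, so that the choice of the real representative of `q` is immaterial. -/
def Joint.pose (j : Joint) (q : j.kind.Config) : Matrix Hom Hom ℝ :=
  j.home * NormedSpace.exp (j.kind.coord q • hat j.twist)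

/-! ### Vehicle-manipulator systems -/

/-- A vehicle-manipulator system: a moving base carrying a serial chain of `n` rigid links with
one-degree-of-freedom joints. Link `i : Fin n` is attached by joint `i` to its predecessor (the
base for `i = 0`). The generalized inertia matrices of the rigid bodies, each expressed in the
frame of the body, are symmetric and positive definite. -/
structure VMS (n : ℕ) : Type where
  base : BaseKind
  joint : Fin n → Joint
  baseInertia : Matrix Six Six ℝ
  baseInertia_posDef : baseInertia.PosDef
  linkInertia : Fin n → Matrix Six Six ℝ
  linkInertia_posDef : ∀ i, (linkInertia i).PosDef

namespace VMS

variable {n : ℕ} (S : VMS n)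

/-- Coordinates on `𝔤_b`. -/
abbrev B : Type := S.base.Idx

/-- The configuration space `Q_m` of the manipulator. -/
abbrev Qm : Type := ∀ i, (S.joint i).kind.Config

/-- The covering map `ℝⁿ → Q_m`. -/
def proj (u : Fin n → ℝ) : S.Qm := fun i => (S.joint i).kind.proj (u i)

/-- The state space `X = 𝔤_b* × T*Q_m`, with `T*Q_m = Q_m × ℝⁿ`; a state is `(p, q, π)`. -/
abbrev State : Type := (S.B → ℝ) × S.Qm × (Fin n → ℝ)

/-- `posesUpTo q k` is the pose, with respect to the base, of the `k`-th body of the chain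
(body `0` is the base, body `k + 1` is link `k`). -/
def posesUpTo (q : S.Qm) : ℕ → Matrix Hom Hom ℝ
  | 0 => 1
  | k + 1 => if hk : k < n then posesUpTo q k * (S.joint ⟨k, hk⟩).pose (q ⟨k, hk⟩)
      else posesUpTo q k

/-- The pose `H_i^b(q)` of link `i` with respect to the base. -/
def linkPose (q : S.Qm) (i : Fin n) : Matrix Hom Hom ℝ := S.posesUpTo q (i + 1)

/-- The geometric Jacobian `J_i^{i,b}(q)` of link `i` with respect to the base: its column `j` is
`Ad_{H_j^i(q)} S_j` for `j ≤ i` and zero for `j > i`. -/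
def jacobian (q : S.Qm) (i : Fin n) : Matrix Six (Fin n) ℝ :=
  Matrix.of fun r j =>
    if j ≤ i then (Ad ((S.linkPose q i)⁻¹ * S.linkPose q j) *ᵥ (S.joint j).twist) r else 0

/-- `Ad_{H_b^i(q)}`. -/
def adBaseToLink (q : S.Qm) (i : Fin n) : Matrix Six Six ℝ := Ad (S.linkPose q i)⁻¹

/-- The locked inertia matrix `M_b(q)`. -/
def massB (q : S.Qm) : Matrix S.B S.B ℝ :=
  S.base.inclᵀ * (S.baseInertia +
    ∑ i, (S.adBaseToLink q i)ᵀ * S.linkInertia i * S.adBaseToLink q i) * S.base.incl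

/-- The coupling inertia matrix `M_bm(q)`. -/
def massBM (q : S.Qm) : Matrix S.B (Fin n) ℝ :=
  ∑ i, S.base.inclᵀ * (S.adBaseToLink q i)ᵀ * S.linkInertia i * S.jacobian q i

/-- The manipulator inertia matrix `M_m(q)`. -/
def massM (q : S.Qm) : Matrix (Fin n) (Fin n) ℝ :=
  ∑ i, (S.jacobian q i)ᵀ * S.linkInertia i * S.jacobian q i

/-- The mass matrix `M(q)`. -/
def mass (q : S.Qm) : Matrix (S.B ⊕ Fin n) (S.B ⊕ Fin n) ℝ :=
  Matrix.fromBlocks (S.massB q) (S.massBM q) (S.massBM q)ᵀ (S.massM q)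

/-- The reduced kinetic-energy Lagrangian `L(v, q, q̇)` on `𝔤_b × TQ_m`. -/
def lagrangian (v : S.B → ℝ) (q : S.Qm) (q' : Fin n → ℝ) : ℝ :=
  (1 / 2) * (Sum.elim v q' ⬝ᵥ (S.mass q *ᵥ Sum.elim v q'))

/-- The left-invariant Lagrangian on `T(G_b × Q_m)` whose reduction is `lagrangian`. -/
def fullLagrangian (H H' : Matrix Hom Hom ℝ) (q : S.Qm) (q' : Fin n → ℝ) : ℝ :=
  S.lagrangian (S.base.bodyVelocity H H') q q'

/-- The conjugate momentum `p = ∂L/∂v`. -/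
def baseMomentum (v : S.B → ℝ) (q : S.Qm) (q' : Fin n → ℝ) : S.B → ℝ :=
  fun i => fderiv ℝ (fun v₁ => S.lagrangian v₁ q q') v (Pi.single i 1)

/-- The conjugate momentum `π = ∂L/∂q̇`. -/
def jointMomentum (v : S.B → ℝ) (q : S.Qm) (q' : Fin n → ℝ) : Fin n → ℝ :=
  fun i => fderiv ℝ (fun q₁ => S.lagrangian v q q₁) q' (Pi.single i 1)

/-- `H` is the Legendre transform of the reduced Lagrangian: the Legendre map
`(v, q̇) ↦ (∂L/∂v, ∂L/∂q̇)` is invertible over every `q`, and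
`H(p, q, π) = ⟨p, v⟩ + ⟨π, q̇⟩ - L(v, q, q̇)` where `(p, π)` is the image of `(v, q̇)`. -/
def IsLegendreTransform (H : S.State → ℝ) : Prop :=
  ∀ q : S.Qm,
    Function.Bijective (fun z : (S.B → ℝ) × (Fin n → ℝ) =>
      (S.baseMomentum z.1 q z.2, S.jointMomentum z.1 q z.2)) ∧
    ∀ (v : S.B → ℝ) (q' : Fin n → ℝ),
      H (S.baseMomentum v q q', q, S.jointMomentum v q q') =
        S.baseMomentum v q q' ⬝ᵥ v + S.jointMomentum v q q' ⬝ᵥ q' - S.lagrangian v q q'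

/-- The kinetic Hamiltonian `H(p, q, π) = ½ (p, π)ᵀ M(q)⁻¹ (p, π)`. -/
def hamiltonian (x : S.State) : ℝ :=
  (1 / 2) * (Sum.elim x.1 x.2.2 ⬝ᵥ ((S.mass x.2.1)⁻¹ *ᵥ Sum.elim x.1 x.2.2))

/-- The partial gradients `(∂F/∂p, ∂F/∂q, ∂F/∂π)` of a function on the state space. The partial
derivatives in `q` are those along the coordinate directions of the group `Q_m`. -/
def grad (F : S.State → ℝ) (x : S.State) : S.B ⊕ (Fin n ⊕ Fin n) → ℝ :=
  Sum.elim (fun i => fderiv ℝ (fun p => F (p, x.2.1, x.2.2)) x.1 (Pi.single i 1))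
    (Sum.elim
      (fun i => fderiv ℝ (fun δ : Fin n → ℝ => F (x.1, x.2.1 + S.proj δ, x.2.2)) 0
        (Pi.single i 1))
      (fun i => fderiv ℝ (fun π => F (x.1, x.2.1, π)) x.2.2 (Pi.single i 1)))

/-- The interconnection matrix `J(p)`. -/
def interconnection (p : S.B → ℝ) : Matrix (S.B ⊕ (Fin n ⊕ Fin n)) (S.B ⊕ (Fin n ⊕ Fin n)) ℝ :=
  Matrix.fromBlocks (S.base.adTilde p) 0 0 (Matrix.fromBlocks 0 1 (-1) 0)

/-- The input matrix `G`. -/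
def input : Matrix (S.B ⊕ (Fin n ⊕ Fin n)) (S.B ⊕ Fin n) ℝ :=
  Matrix.fromBlocks 1 0 0 (Matrix.fromRows 0 1)

/-- A twice continuously differentiable motion of the system: a curve `h` in `G_b` and a curve in
`Q_m`, the latter given by a lift `u` to `ℝⁿ`. -/
structure IsMotion (h : ℝ → Matrix Hom Hom ℝ) (u : ℝ → Fin n → ℝ) : Prop where
  mem : ∀ t, h t ∈ S.base.group
  contDiff_base : ∀ i j, ContDiff ℝ 2 fun t => h t i j
  contDiff_joint : ContDiff ℝ 2 u

/-- The base twist `v(t)` along a curve `h` in `G_b`. -/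
def baseTwist (h : ℝ → Matrix Hom Hom ℝ) (t : ℝ) : S.B → ℝ :=
  S.base.bodyVelocity (h t) (matDeriv h t)

/-- `p` and `π` are the momenta conjugate to the velocities along the motion, on `[a, b]`. -/
def AreMomenta (a b : ℝ) (h : ℝ → Matrix Hom Hom ℝ) (u : ℝ → Fin n → ℝ)
    (p : ℝ → S.B → ℝ) (π : ℝ → Fin n → ℝ) : Prop :=
  ∀ t ∈ Set.Icc a b,
    p t = S.baseMomentum (S.baseTwist h t) (S.proj (u t)) (deriv u t) ∧
    π t = S.jointMomentum (S.baseTwist h t) (S.proj (u t)) (deriv u t)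

/-- The Lagrange–d'Alembert principle on `[a, b]` for the left-invariant Lagrangian on
`T(G_b × Q_m)`, with the base wrench `w` (expressed in the base frame) and the joint torques `τ`:
`δ ∫ L dt + ∫ (⟨w, h⁻¹ δh⟩ + ⟨τ, δq⟩) dt = 0` for all variations with fixed end points. -/
def LagrangeDAlembert (a b : ℝ) (h : ℝ → Matrix Hom Hom ℝ) (u : ℝ → Fin n → ℝ)
    (w : ℝ → S.B → ℝ) (τ : ℝ → Fin n → ℝ) : Prop :=
  ∀ (hv : ℝ → ℝ → Matrix Hom Hom ℝ) (uv : ℝ → ℝ → Fin n → ℝ),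
    (∀ ε t, hv ε t ∈ S.base.group) →
    (∀ i j, ContDiff ℝ 2 fun z : ℝ × ℝ => hv z.1 z.2 i j) →
    (ContDiff ℝ 2 fun z : ℝ × ℝ => uv z.1 z.2) →
    (∀ t, hv 0 t = h t ∧ uv 0 t = u t) →
    (∀ ε, hv ε a = h a ∧ hv ε b = h b ∧ uv ε a = u a ∧ uv ε b = u b) →
    HasDerivAt
      (fun ε => ∫ t in a..b,
        S.fullLagrangian (hv ε t) (matDeriv (hv ε) t) (S.proj (uv ε t)) (deriv (uv ε) t))
      (-∫ t in a..b,
        (w t ⬝ᵥ S.base.bodyVelocity (h t) (matDeriv (fun ε => hv ε t) 0) +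
          τ t ⬝ᵥ deriv (fun ε => uv ε t) 0))
      0

/-- The reduced Lagrange–d'Alembert principle on `[a, b]`, for the curve
`(v, q, q̇)` in `𝔤_b × TQ_m`:
`δ ∫ L(v, q, q̇) dt + ∫ (⟨w, η⟩ + ⟨τ, δq⟩) dt = 0` for all variations
`δv = η̇ + ad_v η` and `δq`, where `η` and `δq` vanish at the end points. -/
def ReducedLagrangeDAlembert (a b : ℝ) (v : ℝ → S.B → ℝ) (u : ℝ → Fin n → ℝ)
    (w : ℝ → S.B → ℝ) (τ : ℝ → Fin n → ℝ) : Prop :=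
  ∀ (η : ℝ → S.B → ℝ) (δq : ℝ → Fin n → ℝ),
    ContDiff ℝ 1 η → ContDiff ℝ 1 δq →
    η a = 0 → η b = 0 → δq a = 0 → δq b = 0 →
    HasDerivAt
      (fun ε : ℝ => ∫ t in a..b,
        S.lagrangian (v t + ε • (deriv η t + S.base.ad (v t) *ᵥ η t))
          (S.proj (u t + ε • δq t)) (deriv u t + ε • deriv δq t))
      (-∫ t in a..b, (w t ⬝ᵥ η t + τ t ⬝ᵥ δq t))
      0

/-- The port-Hamiltonian equations on `[a, b]` with Hamiltonian `H`, inputs `(w, τ)` and outputs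
`(v, q̇)`: `ẋ = J(p) ∂H/∂x + G (w, τ)` and `(v, q̇) = Gᵀ ∂H/∂x`, for the state
`x(t) = (p(t), q(t), π(t))`, where the curve `q` in `Q_m` is given by its lift `u`. -/
def PortHamiltonian (H : S.State → ℝ) (a b : ℝ) (v : ℝ → S.B → ℝ)
    (p : ℝ → S.B → ℝ) (u : ℝ → Fin n → ℝ) (π : ℝ → Fin n → ℝ)
    (w : ℝ → S.B → ℝ) (τ : ℝ → Fin n → ℝ) : Prop :=
  ∀ t ∈ Set.Icc a b,
    HasDerivWithinAt (fun s => (Sum.elim (p s) (Sum.elim (u s) (π s)) : S.B ⊕ (Fin n ⊕ Fin n) → ℝ))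
      (S.interconnection (p t) *ᵥ S.grad H (p t, S.proj (u t), π t) +
        S.input *ᵥ Sum.elim (w t) (τ t))
      (Set.Icc a b) t ∧
    Sum.elim (v t) (deriv u t) = S.inputᵀ *ᵥ S.grad H (p t, S.proj (u t), π t)

end VMS

end VehicleManipulator

end

/-!
# Port-Hamiltonian dynamics of vehicle-manipulator systems

The quadratic form of the mass matrix is twice the kinetic energy, that is, the sum of the kinetic
energies of the bodies (`VMS.dotProduct_mass_mulVec`). It is positive definite because the
velocities of the bodies determine those of the base and, going outwards along the chain, of the
joints (`VMS.eq_zero_of_jacobian_mulVec`). Hence the Legendre map `z ↦ M(q) z` is invertible and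
everything in the first part is linear algebra, up to the smooth dependence on `q`: the
configuration of a revolute joint lives on the circle, and the pose is a smooth function of its lift
to the line by Rodrigues' formula (`Joint.contDiff_pose`).

The equivalence of the equations of motion passes through the Euler–Poincaré equation of the base
and the Euler–Lagrange equation of the joints (`VMS.EulerLagrange`),
`ṗ = ad_vᵀ p + w`, `π̇ = ∂L/∂q + τ`.

* Both variational principles are about one integral (`VMS.firstVariation`). For a variation
  of the motion itself this is the Maurer–Cartan relation `δv = η̇ + ad_v η` with `η = h⁻¹ δh`
  (`BaseKind.hasDerivAt_bodyVelocity`), which rests on the fact that velocities of curves in `G_b`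
  are left translates of elements of `𝔤_b` (`BaseKind.hat_incl_bodyVelocity`). Integration by parts
  (`VMS.integral_firstVariation_add`) shows that the equations of motion imply both principles.
* Conversely the fundamental lemma of the calculus of variations needs only fields `η = φ e_i`
  with a scalar `φ` and a basis vector `e_i` of `𝔤_b`. They are realized by the families
  `h(t) g_i(ε φ(t))`, where `g_i` is an explicit curve of rotations or translations with velocity
  `e_i` at the identity (`BaseKind.exists_curve`), so that the exponential map of `G_b` is
  not needed.
* The gradient of the Hamiltonian at the momenta of `(v, q, q̇)` is `(v, -∂L/∂q, q̇)`
  (`VMS.grad_hamiltonian`). So the output equation says that `p` and `π` are the conjugate momenta,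
  and given this the state equation is the system of Euler–Lagrange equations.

Matrices carry no global norm, so derivatives of matrix-valued functions are taken entry by entry.
-/

namespace VehicleManipulator

/-! ### Calculus of matrix-valued functions, entry by entry -/

section MatrixCalculus

variable {E : Type*} [NormedAddCommGroup E] [NormedSpace ℝ E] {r : WithTop ℕ∞}
  {l m o : Type*} [Fintype m]

theorem contDiff_mul_apply {A : E → Matrix l m ℝ} {B : E → Matrix m o ℝ}
    (hA : ∀ i j, ContDiff ℝ r fun x => A x i j) (hB : ∀ i j, ContDiff ℝ r fun x => B x i j)
    (i : l) (j : o) : ContDiff ℝ r fun x => (A x * B x) i j := by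
  simp only [Matrix.mul_apply]
  exact ContDiff.sum fun k _ => (hA i k).mul (hB k j)

theorem contDiff_const_mul_apply (C : Matrix l m ℝ) {B : E → Matrix m o ℝ}
    (hB : ∀ i j, ContDiff ℝ r fun x => B x i j) (i : l) (j : o) :
    ContDiff ℝ r fun x => (C * B x) i j :=
  contDiff_mul_apply (A := fun _ => C) (fun _ _ => contDiff_const) hB i j

theorem contDiff_mul_const_apply {A : E → Matrix l m ℝ} (C : Matrix m o ℝ)
    (hA : ∀ i j, ContDiff ℝ r fun x => A x i j) (i : l) (j : o) :
    ContDiff ℝ r fun x => (A x * C) i j :=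
  contDiff_mul_apply (B := fun _ => C) hA (fun _ _ => contDiff_const) i j

theorem contDiff_mulVec_apply {A : E → Matrix l m ℝ} {v : E → m → ℝ}
    (hA : ∀ i j, ContDiff ℝ r fun x => A x i j) (hv : ∀ j, ContDiff ℝ r fun x => v x j)
    (i : l) : ContDiff ℝ r fun x => (A x *ᵥ v x) i := by
  simp only [Matrix.mulVec, dotProduct]
  exact ContDiff.sum fun k _ => (hA i k).mul (hv k)

theorem contDiff_dotProduct {v w : E → m → ℝ}
    (hv : ∀ j, ContDiff ℝ r fun x => v x j) (hw : ∀ j, ContDiff ℝ r fun x => w x j) :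
    ContDiff ℝ r fun x => v x ⬝ᵥ w x := by
  simp only [dotProduct]
  exact ContDiff.sum fun k _ => (hv k).mul (hw k)

theorem hasDerivAt_mul_apply {A : ℝ → Matrix l m ℝ} {B : ℝ → Matrix m o ℝ} {A' : Matrix l m ℝ}
    {B' : Matrix m o ℝ} {t : ℝ} (hA : ∀ i j, HasDerivAt (fun s => A s i j) (A' i j) t)
    (hB : ∀ i j, HasDerivAt (fun s => B s i j) (B' i j) t) (i : l) (j : o) :
    HasDerivAt (fun s => (A s * B s) i j) ((A' * B t + A t * B') i j) t := by
  simp only [Matrix.mul_apply, Matrix.add_apply, ← Finset.sum_add_distrib]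
  exact HasDerivAt.fun_sum fun k _ => (hA i k).mul (hB k j)

variable [DecidableEq m]

theorem contDiff_det {A : E → Matrix m m ℝ} (hA : ∀ i j, ContDiff ℝ r fun x => A x i j) :
    ContDiff ℝ r fun x => (A x).det := by
  simp only [Matrix.det_apply']
  exact ContDiff.sum fun σ _ => contDiff_const.mul (contDiff_prod fun i _ => hA _ _)

theorem contDiff_inv_apply {A : E → Matrix m m ℝ} (hA : ∀ i j, ContDiff ℝ r fun x => A x i j)
    (hu : ∀ x, IsUnit (A x).det) (i j : m) : ContDiff ℝ r fun x => (A x)⁻¹ i j := by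
  simp only [Matrix.inv_def, Matrix.smul_apply, Ring.inverse_eq_inv', smul_eq_mul,
    Matrix.adjugate_apply]
  refine ((contDiff_det hA).inv fun x => (hu x).ne_zero).mul (contDiff_det fun k k' => ?_)
  by_cases h : k = j
  · subst h
    simpa only [Matrix.updateRow_self] using contDiff_const
  · simpa only [Matrix.updateRow_ne h] using hA k k'

/-- The rule `(A⁻¹)' = -A⁻¹ A' A⁻¹`. -/
theorem hasDerivAt_inv_apply {A : ℝ → Matrix m m ℝ} {A' : Matrix m m ℝ} {t : ℝ}
    (hA : ∀ i j, ContDiff ℝ 1 fun s => A s i j) (hu : ∀ s, IsUnit (A s).det)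
    (hA' : ∀ i j, HasDerivAt (fun s => A s i j) (A' i j) t) (i j : m) :
    HasDerivAt (fun s => (A s)⁻¹ i j) ((-((A t)⁻¹ * A' * (A t)⁻¹)) i j) t := by
  let K' : Matrix m m ℝ := Matrix.of fun i j => deriv (fun s => (A s)⁻¹ i j) t
  have hK : ∀ i j, HasDerivAt (fun s => (A s)⁻¹ i j) (K' i j) t := fun i j =>
    ((contDiff_inv_apply hA hu i j).differentiable one_ne_zero t).hasDerivAt
  have h0 : K' * A t + (A t)⁻¹ * A' = 0 := by
    ext i j
    have h1 := hasDerivAt_mul_apply hK hA' i j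
    simp only [Matrix.nonsing_inv_mul _ (hu _)] at h1
    exact h1.unique (hasDerivAt_const t _)
  have h2 : K' = -((A t)⁻¹ * A' * (A t)⁻¹) := by
    rw [← neg_mul, ← eq_neg_of_add_eq_zero_left h0, Matrix.mul_nonsing_inv_cancel_right _ _ (hu t)]
  exact h2 ▸ hK i j

end MatrixCalculus

/-! ### Parametric integrals, mixed derivatives and test functions -/

theorem hasDerivAt_intervalIntegral_of_continuous {F F' : ℝ → ℝ → ℝ} {a b : ℝ}
    (hF : Continuous fun z : ℝ × ℝ => F z.1 z.2) (hF' : Continuous fun z : ℝ × ℝ => F' z.1 z.2)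
    (hd : ∀ ε t, HasDerivAt (fun e => F e t) (F' ε t) ε) (ε : ℝ) :
    HasDerivAt (fun e => ∫ t in a..b, F e t) (∫ t in a..b, F' ε t) ε := by
  have hc : ∀ e, Continuous (F e) := fun e => hF.comp (Continuous.prodMk_right e)
  obtain ⟨C, hC⟩ := ((isCompact_Icc (a := ε - 1) (b := ε + 1)).prod
    (isCompact_uIcc (a := a) (b := b))).exists_bound_of_continuousOn hF'.continuousOn
  refine (intervalIntegral.hasDerivAt_integral_of_dominated_loc_of_deriv_le
    (bound := fun _ => C) (s := Set.Icc (ε - 1) (ε + 1)) (Icc_mem_nhds (by linarith) (by linarith))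
    (Filter.Eventually.of_forall fun e => (hc e).aestronglyMeasurable)
    ((hc ε).intervalIntegrable _ _)
    (hF'.comp (Continuous.prodMk_right ε)).aestronglyMeasurable
    (Filter.Eventually.of_forall fun t ht e he => hC (e, t) ⟨he, Set.uIoc_subset_uIcc ht⟩)
    intervalIntegrable_const
    (Filter.Eventually.of_forall fun t _ e _ => hd e t)).2

section MixedDerivatives

variable {F : Type*} [NormedAddCommGroup F] [NormedSpace ℝ F] {f : ℝ × ℝ → F}
  {m r : WithTop ℕ∞}

theorem hasDerivAt_prodMk_left (hf : ContDiff ℝ 1 f) (ε t : ℝ) :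
    HasDerivAt (fun e => f (e, t)) (fderiv ℝ f (ε, t) (1, 0)) ε :=
  (hf.differentiable one_ne_zero (ε, t)).hasFDerivAt.comp_hasDerivAt ε
    ((hasDerivAt_id ε).prodMk (hasDerivAt_const ε t))

theorem hasDerivAt_prodMk_right (hf : ContDiff ℝ 1 f) (ε t : ℝ) :
    HasDerivAt (fun s => f (ε, s)) (fderiv ℝ f (ε, t) (0, 1)) t :=
  (hf.differentiable one_ne_zero (ε, t)).hasFDerivAt.comp_hasDerivAt t
    ((hasDerivAt_const t ε).prodMk (hasDerivAt_id t))

theorem contDiff_deriv_left (hf : ContDiff ℝ r f) (hm : m + 1 ≤ r) :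
    ContDiff ℝ m fun z : ℝ × ℝ => deriv (fun e => f (e, z.2)) z.1 := by
  simp only [(hasDerivAt_prodMk_left (hf.of_le (le_add_self.trans hm)) _ _).deriv]
  exact (hf.fderiv_right hm).clm_apply contDiff_const

theorem contDiff_deriv_right (hf : ContDiff ℝ r f) (hm : m + 1 ≤ r) :
    ContDiff ℝ m fun z : ℝ × ℝ => deriv (fun s => f (z.1, s)) z.2 := by
  simp only [(hasDerivAt_prodMk_right (hf.of_le (le_add_self.trans hm)) _ _).deriv]
  exact (hf.fderiv_right hm).clm_apply contDiff_const

/-- Mixed partial derivatives of a `C²` function commute. -/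
theorem hasDerivAt_deriv_comm (hf : ContDiff ℝ 2 f) (ε t : ℝ) :
    HasDerivAt (fun e => deriv (fun s => f (e, s)) t)
      (deriv (fun s => deriv (fun e => f (e, s)) ε) t) ε := by
  have h1 : ContDiff ℝ 1 f := hf.of_le one_le_two
  have h2 : HasFDerivAt (fderiv ℝ f) (fderiv ℝ (fderiv ℝ f) (ε, t)) (ε, t) :=
    ((hf.fderiv_right (m := 1) (by norm_num)).differentiable one_ne_zero (ε, t)).hasFDerivAt
  have hs := (hf.contDiffAt (x := (ε, t))).isSymmSndFDerivAt (by simp)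
  have hε : HasDerivAt (fun e => fderiv ℝ f (e, t) (0, 1))
      (fderiv ℝ (fderiv ℝ f) (ε, t) (1, 0) (0, 1)) ε := by
    have := (h2.comp_hasDerivAt ε ((hasDerivAt_id ε).prodMk (hasDerivAt_const ε t)))
    simpa using this.clm_apply (hasDerivAt_const ε ((0, 1) : ℝ × ℝ))
  have ht : HasDerivAt (fun s => fderiv ℝ f (ε, s) (1, 0))
      (fderiv ℝ (fderiv ℝ f) (ε, t) (0, 1) (1, 0)) t := by
    have := (h2.comp_hasDerivAt t ((hasDerivAt_const t ε).prodMk (hasDerivAt_id t)))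
    simpa using this.clm_apply (hasDerivAt_const t ((1, 0) : ℝ × ℝ))
  simp only [(hasDerivAt_prodMk_right h1 _ _).deriv, (hasDerivAt_prodMk_left h1 _ _).deriv]
  rw [ht.deriv, hs.eq]
  exact hε

end MixedDerivatives

/-- The fundamental lemma of the calculus of variations, up to the end points. -/
theorem eqOn_zero_of_integral_mul_eq_zero {f : ℝ → ℝ} {a b : ℝ} (hab : a < b)
    (hf : ContinuousOn f (Set.Icc a b))
    (h : ∀ φ : ℝ → ℝ, ContDiff ℝ 2 φ → φ a = 0 → φ b = 0 → ∫ t in a..b, f t * φ t = 0) :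
    ∀ t ∈ Set.Icc a b, f t = 0 := by
  have hae : ∀ᵐ x, x ∈ Set.Ioo a b → f x = 0 := by
    refine isOpen_Ioo.ae_eq_zero_of_integral_contDiff_smul_eq_zero
      ((hf.mono Set.Ioo_subset_Icc_self).locallyIntegrableOn measurableSet_Ioo) ?_
    intro g hg _ hs
    have hz : ∀ x, x ∉ Set.Ioo a b → g x = 0 := fun x hx =>
      image_eq_zero_of_notMem_tsupport fun hx' => hx (hs hx')
    have := h g (hg.of_le (WithTop.coe_le_coe.2 le_top)) (hz a (by simp)) (hz b (by simp))
    rw [intervalIntegral.integral_of_le hab.le,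
      MeasureTheory.setIntegral_eq_integral_of_forall_compl_eq_zero] at this
    · simpa [mul_comm] using this
    · intro x hx
      rw [hz x fun hx' => hx (Set.Ioo_subset_Ioc_self hx'), mul_zero]
  have hIoo : Set.EqOn f 0 (Set.Ioo a b) :=
    MeasureTheory.Measure.eqOn_open_of_ae_eq (μ := MeasureTheory.volume)
      ((MeasureTheory.ae_restrict_iff' measurableSet_Ioo).2 hae) isOpen_Ioo
      (hf.mono Set.Ioo_subset_Icc_self) continuousOn_const
  have := hIoo.of_subset_closure hf continuousOn_const Set.Ioo_subset_Icc_self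
    (by rw [closure_Ioo hab.ne])
  exact this

/-! ### The Lie algebra of the group of the base -/

theorem vee_add (A B : Matrix Hom Hom ℝ) : vee (A + B) = vee A + vee B := by
  ext i
  rcases i with i | i <;> fin_cases i <;> simp [vee]

theorem vee_smul (c : ℝ) (A : Matrix Hom Hom ℝ) : vee (c • A) = c • vee A := by
  ext i
  rcases i with i | i <;> fin_cases i <;> simp [vee]

/-- `hat` turns the bracket `ad` into the commutator of matrices. -/
theorem hat_ad_mulVec (V W : Six → ℝ) : hat (ad V *ᵥ W) = hat V * hat W - hat W * hat V := by
  ext i j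
  rcases i with i | i <;> rcases j with j | j <;> fin_cases i <;> fin_cases j <;>
    simp [hat, ad, skew, Matrix.mulVec, dotProduct, Matrix.mul_apply, Fin.sum_univ_three] <;> ring

theorem ad_mulVec_comm (V W : Six → ℝ) : ad V *ᵥ W = -(ad W *ᵥ V) := by
  have h : hat (-(ad W *ᵥ V)) = -hat (ad W *ᵥ V) := by
    ext i j
    rcases i with i | i <;> rcases j with j | j <;> fin_cases i <;> fin_cases j <;> simp [hat, skew]
  rw [← vee_hat (ad V *ᵥ W), ← vee_hat (-(ad W *ᵥ V)), h, hat_ad_mulVec, hat_ad_mulVec, neg_sub]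

namespace BaseKind

variable (k : BaseKind)

theorem ad_mulVec_comm (v η : k.Idx → ℝ) : k.ad v *ᵥ η = -(k.ad η *ᵥ v) := by
  have h : ∀ x y : k.Idx → ℝ, k.ad x *ᵥ y =
      k.inclᵀ *ᵥ (VehicleManipulator.ad (k.incl *ᵥ x) *ᵥ (k.incl *ᵥ y)) := fun x y => by
    simp only [BaseKind.ad, Matrix.mulVec_mulVec, Matrix.mul_assoc]
  rw [h, h, VehicleManipulator.ad_mulVec_comm, Matrix.mulVec_neg]

theorem incl_transpose_mulVec_incl (v : k.Idx → ℝ) : k.inclᵀ *ᵥ (k.incl *ᵥ v) = v := by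
  rw [Matrix.mulVec_mulVec, k.incl_transpose_mul, Matrix.one_mulVec]

theorem incl_mulVec_injective : Function.Injective (k.incl *ᵥ ·) := fun v w h => by
  rw [← k.incl_transpose_mulVec_incl v, ← k.incl_transpose_mulVec_incl w]
  exact congrArg _ h

theorem transpose_adTilde (p : k.Idx → ℝ) : (k.adTilde p)ᵀ = -k.adTilde p := by
  have h : ∀ i j, k.adTilde p i j = (k.ad (Pi.single j 1) *ᵥ Pi.single i 1) ⬝ᵥ p := fun i j => by
    simp [adTilde, Matrix.mulVec, dotProduct, Pi.single_apply]
  ext i j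
  rw [Matrix.transpose_apply, Matrix.neg_apply, h, h, k.ad_mulVec_comm, neg_dotProduct]

end BaseKind

/-! ### The group of the base -/

theorem isUnit_det_of_mem_SE3 {H : Matrix Hom Hom ℝ} (h : H ∈ SE3) : IsUnit H.det := by
  obtain ⟨R, hR, ξ, rfl⟩ := h
  rw [Matrix.det_fromBlocks_zero₂₁, (Matrix.mem_specialOrthogonalGroup_iff.1 hR).2]
  simp

theorem mul_mem_SE3 {H K : Matrix Hom Hom ℝ} (hH : H ∈ SE3) (hK : K ∈ SE3) : H * K ∈ SE3 := by
  obtain ⟨R, hR, ξ, rfl⟩ := hH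
  obtain ⟨Q, hQ, ζ, rfl⟩ := hK
  refine ⟨R * Q, mul_mem hR hQ, R *ᵥ ζ + ξ, ?_⟩
  rw [Matrix.fromBlocks_multiply]
  congr 1
  · simp
  · ext i j
    simp [Matrix.mul_apply, Matrix.mulVec, dotProduct]
  · simp
  · simp

theorem rotation_mem (θ : ℝ) :
    !![Real.cos θ, -Real.sin θ, 0; Real.sin θ, Real.cos θ, 0; 0, 0, 1] ∈
      Matrix.specialOrthogonalGroup (Fin 3) ℝ := by
  have h := Real.sin_sq_add_cos_sq θ
  rw [Matrix.mem_specialOrthogonalGroup_iff, Matrix.mem_orthogonalGroup_iff]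
  constructor
  · ext i j
    fin_cases i <;> fin_cases j <;>
      simp [Matrix.mul_apply, Fin.sum_univ_three] <;> linarith
  · simp [Matrix.det_fin_three]
    linarith

theorem planarPose_mem_SE3 (θ x y : ℝ) : planarPose θ x y ∈ SE3 :=
  ⟨_, rotation_mem θ, ![x, y, 0], rfl⟩

theorem planarPose_mul (θ x y θ' x' y' : ℝ) :
    planarPose θ x y * planarPose θ' x' y' =
      planarPose (θ + θ') (Real.cos θ * x' - Real.sin θ * y' + x)
        (Real.sin θ * x' + Real.cos θ * y' + y) := by
  ext i j
  rcases i with i | i <;> rcases j with j | j <;> fin_cases i <;> fin_cases j <;>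
    simp [planarPose, Matrix.mul_apply, Fin.sum_univ_three, Real.cos_add, Real.sin_add] <;> ring

theorem BaseKind.group_subset_SE3 (k : BaseKind) : k.group ⊆ SE3 := by
  cases k
  · exact subset_rfl
  · rintro _ ⟨θ, x, y, rfl⟩
    exact planarPose_mem_SE3 θ x y

theorem BaseKind.mul_mem_group (k : BaseKind) {H K : Matrix Hom Hom ℝ} (hH : H ∈ k.group)
    (hK : K ∈ k.group) : H * K ∈ k.group := by
  cases k
  · exact mul_mem_SE3 hH hK
  · obtain ⟨θ, x, y, rfl⟩ := hH
    obtain ⟨θ', x', y', rfl⟩ := hK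
    exact ⟨_, _, _, planarPose_mul ..⟩

/-- A matrix of the form `(Ω, x; 0, 0)` with skew-symmetric `Ω` lies in `se(3)`. -/
theorem hat_vee {A : Matrix Hom Hom ℝ} (h0 : ∀ j, A (Sum.inr 0) j = 0)
    (hs : ∀ i j, A (Sum.inl i) (Sum.inl j) = -A (Sum.inl j) (Sum.inl i)) : hat (vee A) = A := by
  have hd : ∀ i, A (Sum.inl i) (Sum.inl i) = 0 := fun i => by linarith [hs i i]
  ext i j
  rcases i with i | i
  · rcases j with j | j
    · fin_cases i <;> fin_cases j <;>
        simp [hat, vee, skew, hd, hs 0 1, hs 1 2, hs 2 0]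
    · fin_cases i <;> fin_cases j <;> simp [hat, vee]
  · fin_cases i
    rcases j with j | j <;> fin_cases j <;> simp [hat, h0]

/-- Velocities of curves in `SE(3)`, pulled back to the identity, lie in `se(3)`. -/
theorem hat_vee_inv_mul_deriv {h : ℝ → Matrix Hom Hom ℝ} (hmem : ∀ t, h t ∈ SE3)
    {h' : Matrix Hom Hom ℝ} {t : ℝ} (hd : ∀ i j, HasDerivAt (fun s => h s i j) (h' i j) t) :
    hat (vee ((h t)⁻¹ * h')) = (h t)⁻¹ * h' := by
  choose R hR ξ hh using hmem
  set A := (h t)⁻¹ * h' with hA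
  have hA' : h t * A = h' := by
    rw [hA, Matrix.mul_nonsing_inv_cancel_left _ _ (isUnit_det_of_mem_SE3 ⟨R t, hR t, ξ t, hh t⟩)]
  have hrow : ∀ j, A (Sum.inr 0) j = 0 := fun j => by
    have h1 : h' (Sum.inr 0) j = 0 := by
      refine (hd (Sum.inr 0) j).unique ?_
      convert hasDerivAt_const t ((1 : Matrix Hom Hom ℝ) (Sum.inr 0) j) using 2 with s
      rw [hh s]
      rcases j with j | j
      · simp
      · fin_cases j
        rfl
    rw [← hA', hh t] at h1
    simpa [Matrix.mul_apply] using h1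
  refine hat_vee hrow fun i j => ?_
  let R' : Matrix (Fin 3) (Fin 3) ℝ := Matrix.of fun i j => h' (Sum.inl i) (Sum.inl j)
  have hR' : ∀ i j, HasDerivAt (fun s => R s i j) (R' i j) t := fun i j => by
    have := hd (Sum.inl i) (Sum.inl j)
    simp only [hh, Matrix.fromBlocks_apply₁₁] at this
    exact this
  have horth : ∀ s, (R s)ᵀ * R s = 1 := fun s =>
    (Matrix.mem_orthogonalGroup_iff' _ _).1 (Matrix.mem_specialOrthogonalGroup_iff.1 (hR s)).1
  have hRA : R' = R t * A.toBlocks₁₁ := by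
    ext i j
    have : h' (Sum.inl i) (Sum.inl j) = (h t * A) (Sum.inl i) (Sum.inl j) := by rw [hA']
    rw [hh t] at this
    simpa [R', Matrix.mul_apply, hrow, Matrix.toBlocks₁₁] using this
  have hz : R'ᵀ * R t + (R t)ᵀ * R' = 0 := by
    ext i j
    have h1 := hasDerivAt_mul_apply (A := fun s => (R s)ᵀ) (A' := R'ᵀ)
      (fun i j => hR' j i) hR' i j
    simp only [horth] at h1
    exact h1.unique (hasDerivAt_const t _)
  rw [hRA, Matrix.transpose_mul, Matrix.mul_assoc, horth, ← Matrix.mul_assoc, horth, mul_one,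
    one_mul] at hz
  have := congrFun (congrFun hz i) j
  simp only [Matrix.add_apply, Matrix.transpose_apply, Matrix.toBlocks₁₁, Matrix.of_apply,
    Matrix.zero_apply] at this
  linarith

theorem BaseKind.hat_incl_bodyVelocity (k : BaseKind) {h : ℝ → Matrix Hom Hom ℝ}
    (hmem : ∀ t, h t ∈ k.group) {h' : Matrix Hom Hom ℝ} {t : ℝ}
    (hd : ∀ i j, HasDerivAt (fun s => h s i j) (h' i j) t) :
    hat (k.incl *ᵥ k.bodyVelocity (h t) h') = (h t)⁻¹ * h' := by
  have hA := hat_vee_inv_mul_deriv (fun t => k.group_subset_SE3 (hmem t)) hd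
  suffices hs : k.incl *ᵥ (k.inclᵀ *ᵥ vee ((h t)⁻¹ * h')) = vee ((h t)⁻¹ * h') by
    rw [bodyVelocity, hs, hA]
  cases k
  · change (1 : Matrix Six Six ℝ) *ᵥ ((1 : Matrix Six Six ℝ)ᵀ *ᵥ _) = _
    rw [Matrix.transpose_one, Matrix.one_mulVec, Matrix.one_mulVec]
  · set A := (h t)⁻¹ * h' with hA_def
    have hA' : h t * A = h' := by
      rw [hA_def, Matrix.mul_nonsing_inv_cancel_left _ _
        (isUnit_det_of_mem_SE3 (BaseKind.planar.group_subset_SE3 (hmem t)))]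
    -- the third row of a planar pose is constant
    have hrow : ∀ j, A (Sum.inl 2) j = 0 := fun j => by
      have hc : ∀ s, h s (Sum.inl 2) j = (1 : Matrix Hom Hom ℝ) (Sum.inl 2) j := fun s => by
        obtain ⟨θ, x, y, hp⟩ := hmem s
        rw [hp]
        rcases j with j | j <;> fin_cases j <;> rfl
      have h1 : h' (Sum.inl 2) j = 0 := by
        have := hd (Sum.inl 2) j
        simp only [hc] at this
        exact this.unique (hasDerivAt_const t _)
      obtain ⟨θ, x, y, hp⟩ := hmem t
      rw [← hA', hp] at h1
      simpa [planarPose, Matrix.mul_apply, Fin.sum_univ_three] using h1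
    -- the third row of `A` vanishes, hence so does the third column of its skew-symmetric block
    have hskew : A (Sum.inl 0) (Sum.inl 2) = 0 := by
      have h1 := congrFun (congrFun hA (Sum.inl 0)) (Sum.inl 2)
      have h2 := congrFun (congrFun hA (Sum.inl 2)) (Sum.inl 0)
      simp [hat, skew] at h1 h2
      rw [← h1]
      have := hrow (Sum.inl 0)
      rw [← h2] at this
      linarith
    change planarIncl *ᵥ (planarInclᵀ *ᵥ vee A) = vee A
    ext i
    rcases i with i | i <;> fin_cases i <;>
      simp [planarIncl, Matrix.mulVec, dotProduct, Fin.sum_univ_three, vee, hrow, hskew]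

theorem translation_mem_SE3 (x : Fin 3 → ℝ) :
    (Matrix.fromBlocks 1 (Matrix.of fun i _ => x i) 0 1 : Matrix Hom Hom ℝ) ∈ SE3 :=
  ⟨1, one_mem _, x, rfl⟩

theorem rotation_mem_SE3 {R : Matrix (Fin 3) (Fin 3) ℝ}
    (hR : R ∈ Matrix.specialOrthogonalGroup (Fin 3) ℝ) :
    (Matrix.fromBlocks R 0 0 1 : Matrix Hom Hom ℝ) ∈ SE3 :=
  ⟨R, hR, 0, rfl⟩

/-- Every basis vector of `𝔤_b` is the velocity at the identity of a smooth curve in `G_b`. -/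
theorem BaseKind.exists_curve (k : BaseKind) (i : k.Idx) :
    ∃ g : ℝ → Matrix Hom Hom ℝ, (∀ s, g s ∈ k.group) ∧ (∀ a b, ContDiff ℝ 2 fun s => g s a b) ∧
      g 0 = 1 ∧ ∀ a b, HasDerivAt (fun s => g s a b) (hat (k.incl *ᵥ Pi.single i 1) a b) 0 := by
  have hc : HasDerivAt Real.cos 0 0 := by simpa using Real.hasDerivAt_cos 0
  have hs : HasDerivAt Real.sin 1 0 := by simpa using Real.hasDerivAt_sin 0
  have hi : HasDerivAt (fun s : ℝ => s) 1 0 := hasDerivAt_id 0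
  have h0 : ∀ c : ℝ, HasDerivAt (fun _ : ℝ => c) 0 0 := hasDerivAt_const 0
  have hcd : ContDiff ℝ 2 Real.cos := Real.contDiff_cos
  have hsd : ContDiff ℝ 2 Real.sin := Real.contDiff_sin
  cases k
  · change Six at i
    change ∃ g : ℝ → Matrix Hom Hom ℝ, (∀ s, g s ∈ SE3) ∧
      (∀ a b, ContDiff ℝ 2 fun s => g s a b) ∧ g 0 = 1 ∧
      ∀ a b, HasDerivAt (fun s => g s a b)
        (hat ((1 : Matrix Six Six ℝ) *ᵥ (Pi.single i 1 : Six → ℝ)) a b) 0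
    rw [Matrix.one_mulVec]
    rcases i with i | i
    · suffices h : ∃ R : ℝ → Matrix (Fin 3) (Fin 3) ℝ,
          (∀ s, R s ∈ Matrix.specialOrthogonalGroup (Fin 3) ℝ) ∧
          (∀ a b, ContDiff ℝ 2 fun s => R s a b) ∧ R 0 = 1 ∧
          ∀ a b, HasDerivAt (fun s => R s a b) (skew (Pi.single i 1) a b) 0 by
        obtain ⟨R, hR, hRc, hR0, hRd⟩ := h
        refine ⟨fun s => Matrix.fromBlocks (R s) 0 0 1, fun s => rotation_mem_SE3 (hR s), ?_,
          by simp only [hR0, Matrix.fromBlocks_one], ?_⟩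
        · rintro (a | a) (b | b)
          · exact hRc a b
          all_goals exact contDiff_const
        · have hsk : skew (fun j => (Pi.single (Sum.inl i) 1 : Six → ℝ) (Sum.inl j)) =
              skew (Pi.single i 1) := by
            congr 1
            ext j
            simp [Pi.single_apply]
          rintro (a | a) (b | b)
          · simpa [hat, hsk] using hRd a b
          all_goals simpa [hat] using h0 _
      fin_cases i
      · refine ⟨fun s => !![1, 0, 0; 0, Real.cos s, -Real.sin s; 0, Real.sin s, Real.cos s],
          fun s => ?_, ?_, ?_, ?_⟩
        · have h := Real.sin_sq_add_cos_sq s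
          rw [Matrix.mem_specialOrthogonalGroup_iff, Matrix.mem_orthogonalGroup_iff]
          constructor
          · ext i j
            fin_cases i <;> fin_cases j <;>
              simp [Matrix.mul_apply, Fin.sum_univ_three] <;> linarith
          · simp [Matrix.det_fin_three]
            linarith
        · intro a b
          fin_cases a <;> fin_cases b <;>
            first | exact contDiff_const | exact hcd | exact hsd | exact hsd.neg
        · ext a b
          fin_cases a <;> fin_cases b <;> simp
        · intro a b
          fin_cases a <;> fin_cases b <;> simp [skew] <;>
            first | exact h0 _ | exact hc | exact hs | exact hs.neg
      · refine ⟨fun s => !![Real.cos s, 0, Real.sin s; 0, 1, 0; -Real.sin s, 0, Real.cos s],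
          fun s => ?_, ?_, ?_, ?_⟩
        · have h := Real.sin_sq_add_cos_sq s
          rw [Matrix.mem_specialOrthogonalGroup_iff, Matrix.mem_orthogonalGroup_iff]
          constructor
          · ext i j
            fin_cases i <;> fin_cases j <;>
              simp [Matrix.mul_apply, Fin.sum_univ_three] <;> linarith
          · simp [Matrix.det_fin_three]
            linarith
        · intro a b
          fin_cases a <;> fin_cases b <;>
            first | exact contDiff_const | exact hcd | exact hsd | exact hsd.neg
        · ext a b
          fin_cases a <;> fin_cases b <;> simp
        · intro a b
          fin_cases a <;> fin_cases b <;> simp [skew] <;>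
            first | exact h0 _ | exact hc | exact hs | exact hs.neg
      · refine ⟨fun s => !![Real.cos s, -Real.sin s, 0; Real.sin s, Real.cos s, 0; 0, 0, 1],
          rotation_mem, ?_, ?_, ?_⟩
        · intro a b
          fin_cases a <;> fin_cases b <;>
            first | exact contDiff_const | exact hcd | exact hsd | exact hsd.neg
        · ext a b
          fin_cases a <;> fin_cases b <;> simp
        · intro a b
          fin_cases a <;> fin_cases b <;> simp [skew] <;>
            first | exact h0 _ | exact hc | exact hs | exact hs.neg
    · refine ⟨fun s => Matrix.fromBlocks 1 (Matrix.of fun j _ => s * (Pi.single i 1 : Fin 3 → ℝ) j) 0 1,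
        fun s => translation_mem_SE3 fun j => s * (Pi.single i 1 : Fin 3 → ℝ) j, ?_, ?_, ?_⟩
      · rintro (a | a) (b | b)
        · exact contDiff_const
        · exact contDiff_id.mul contDiff_const
        all_goals exact contDiff_const
      · simp only [zero_mul]
        exact Matrix.fromBlocks_one
      · rintro (a | a) (b | b)
        · have hsk : skew (fun j => (Pi.single (Sum.inr i) 1 : Six → ℝ) (Sum.inl j)) = 0 := by
            ext a b
            fin_cases a <;> fin_cases b <;> simp [skew]
          simp only [hat, hsk, Matrix.fromBlocks_apply₁₁]
          exact h0 _
        · have hp : (Pi.single (Sum.inr i) 1 : Six → ℝ) (Sum.inr a) =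
              (Pi.single i 1 : Fin 3 → ℝ) a := by
            simp [Pi.single_apply]
          simpa [hat, hp] using hi.mul_const ((Pi.single i 1 : Fin 3 → ℝ) a)
        all_goals simpa [hat] using h0 _
  · change Fin 3 at i
    change ∃ g : ℝ → Matrix Hom Hom ℝ, (∀ s, g s ∈ BaseKind.planar.group) ∧
      (∀ a b, ContDiff ℝ 2 fun s => g s a b) ∧ g 0 = 1 ∧
      ∀ a b, HasDerivAt (fun s => g s a b)
        (hat (planarIncl *ᵥ (Pi.single i 1 : Fin 3 → ℝ)) a b) 0
    have hone : planarPose 0 0 0 = 1 := by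
      ext a b
      rcases a with a | a <;> rcases b with b | b <;> fin_cases a <;> fin_cases b <;>
        first | rfl | simp [planarPose]
    fin_cases i
    · refine ⟨fun s => planarPose s 0 0, fun s => ⟨_, _, _, rfl⟩, ?_, hone, ?_⟩
      · rintro (a | a) (b | b) <;> fin_cases a <;> fin_cases b <;>
          first | exact contDiff_const | exact hcd | exact hsd | exact hsd.neg
      · rintro (a | a) (b | b) <;> fin_cases a <;> fin_cases b <;>
          simp [planarPose, hat, skew, planarIncl] <;>
          first | exact h0 _ | exact hc | exact hs | exact hs.neg
    · refine ⟨fun s => planarPose 0 s 0, fun s => ⟨_, _, _, rfl⟩, ?_, hone, ?_⟩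
      · rintro (a | a) (b | b) <;> fin_cases a <;> fin_cases b <;>
          first | exact contDiff_const | exact contDiff_id
      · rintro (a | a) (b | b) <;> fin_cases a <;> fin_cases b <;>
          simp [planarPose, hat, skew, planarIncl] <;>
          first | exact h0 _ | exact hi
    · refine ⟨fun s => planarPose 0 0 s, fun s => ⟨_, _, _, rfl⟩, ?_, hone, ?_⟩
      · rintro (a | a) (b | b) <;> fin_cases a <;> fin_cases b <;>
          first | exact contDiff_const | exact contDiff_id
      · rintro (a | a) (b | b) <;> fin_cases a <;> fin_cases b <;>
          simp [planarPose, hat, skew, planarIncl] <;>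
          first | exact h0 _ | exact hi

/-! ### Velocities of curves in the group of the base -/

theorem BaseKind.contDiff_bodyVelocity (k : BaseKind) {E : Type*} [NormedAddCommGroup E]
    [NormedSpace ℝ E] {r : WithTop ℕ∞} {H H' : E → Matrix Hom Hom ℝ}
    (hmem : ∀ x, H x ∈ k.group) (hH : ∀ i j, ContDiff ℝ r fun x => H x i j)
    (hH' : ∀ i j, ContDiff ℝ r fun x => H' x i j) :
    ContDiff ℝ r fun x => k.bodyVelocity (H x) (H' x) := by
  have hm := contDiff_mul_apply
    (contDiff_inv_apply hH fun x => isUnit_det_of_mem_SE3 (k.group_subset_SE3 (hmem x))) hH'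
  refine contDiff_pi.2 (contDiff_mulVec_apply (fun _ _ => contDiff_const) fun j => ?_)
  rcases j with j | j
  · fin_cases j <;> exact hm _ _
  · exact hm _ _

theorem hasDerivAt_vee {A : ℝ → Matrix Hom Hom ℝ} {A' : Matrix Hom Hom ℝ} {t : ℝ}
    (hA : ∀ i j, HasDerivAt (fun s => A s i j) (A' i j) t) (j : Six) :
    HasDerivAt (fun s => vee (A s) j) (vee A' j) t := by
  rcases j with j | j
  · fin_cases j <;> exact hA _ _
  · exact hA _ _

/-- The Maurer–Cartan relation: for a family of curves in `G_b`, the velocities `v` and `η` along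
the curves and along the variation satisfy `∂v/∂ε = ∂η/∂t + ad_v η`. -/
theorem BaseKind.hasDerivAt_bodyVelocity (k : BaseKind) {hv : ℝ → ℝ → Matrix Hom Hom ℝ}
    (hmem : ∀ ε t, hv ε t ∈ k.group)
    (hc : ∀ i j, ContDiff ℝ 2 fun z : ℝ × ℝ => hv z.1 z.2 i j) (ε t : ℝ) :
    HasDerivAt (fun e => k.bodyVelocity (hv e t) (matDeriv (hv e) t))
      (deriv (fun s => k.bodyVelocity (hv ε s) (matDeriv (fun e => hv e s) ε)) t +
        k.ad (k.bodyVelocity (hv ε t) (matDeriv (hv ε) t)) *ᵥ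
          k.bodyVelocity (hv ε t) (matDeriv (fun e => hv e t) ε)) ε := by
  have hu : ∀ ε t, IsUnit (hv ε t).det := fun ε t =>
    isUnit_det_of_mem_SE3 (k.group_subset_SE3 (hmem ε t))
  have hce : ∀ s i j, ContDiff ℝ 2 fun e => hv e s i j := fun s i j =>
    (hc i j).comp (contDiff_id.prodMk contDiff_const)
  have hct : ∀ e i j, ContDiff ℝ 2 fun s => hv e s i j := fun e i j =>
    (hc i j).comp (contDiff_const.prodMk contDiff_id)
  set He := matDeriv (fun e => hv e t) ε with hHe
  set Ht := matDeriv (hv ε) t with hHt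
  have hde : ∀ i j, HasDerivAt (fun e => hv e t i j) (He i j) ε := fun i j =>
    ((hce t i j).differentiable two_ne_zero ε).hasDerivAt
  have hdt : ∀ i j, HasDerivAt (fun s => hv ε s i j) (Ht i j) t := fun i j =>
    ((hct ε i j).differentiable two_ne_zero t).hasDerivAt
  set D : Hom → Hom → ℝ := fun i j => deriv (fun s => matDeriv (fun e => hv e s) ε i j) t
  have hD1 : ∀ i j, HasDerivAt (fun e => matDeriv (hv e) t i j) (D i j) ε := fun i j =>
    hasDerivAt_deriv_comm (hc i j) ε t
  have hD2 : ∀ i j, HasDerivAt (fun s => matDeriv (fun e => hv e s) ε i j) (D i j) t := fun i j =>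
    (((contDiff_deriv_left (m := 1) (hc i j) (by norm_num)).comp
      (contDiff_const.prodMk contDiff_id)).differentiable one_ne_zero t).hasDerivAt
  set G := (hv ε t)⁻¹ with hG
  have hℓ : ∀ {A : ℝ → Matrix Hom Hom ℝ} {A' : Matrix Hom Hom ℝ} {x : ℝ},
      (∀ i j, HasDerivAt (fun s => A s i j) (A' i j) x) →
      HasDerivAt (fun s => k.inclᵀ *ᵥ vee (A s)) (k.inclᵀ *ᵥ vee A') x := fun hA =>
    hasDerivAt_pi.2 fun i => by
      simp only [Matrix.mulVec, dotProduct]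
      exact HasDerivAt.fun_sum fun j _ => (hasDerivAt_vee hA j).const_mul _
  have h1 : HasDerivAt (fun e => k.bodyVelocity (hv e t) (matDeriv (hv e) t))
      (k.inclᵀ *ᵥ vee (-(G * He * G) * Ht + G * Matrix.of D)) ε :=
    hℓ (hasDerivAt_mul_apply (B := fun e => matDeriv (hv e) t)
      (hasDerivAt_inv_apply (fun i j => (hce t i j).of_le one_le_two) (fun e => hu e t) hde) hD1)
  have h2 : HasDerivAt (fun s => k.bodyVelocity (hv ε s) (matDeriv (fun e => hv e s) ε))
      (k.inclᵀ *ᵥ vee (-(G * Ht * G) * He + G * Matrix.of D)) t :=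
    hℓ (hasDerivAt_mul_apply (B := fun s => matDeriv (fun e => hv e s) ε)
      (hasDerivAt_inv_apply (fun i j => (hct ε i j).of_le one_le_two) (fun s => hu ε s) hdt) hD2)
  have hE : hat (k.incl *ᵥ k.bodyVelocity (hv ε t) He) = G * He :=
    k.hat_incl_bodyVelocity (h := fun e => hv e t) (fun e => hmem e t) hde
  have hT : hat (k.incl *ᵥ k.bodyVelocity (hv ε t) Ht) = G * Ht :=
    k.hat_incl_bodyVelocity (h := hv ε) (hmem ε) hdt
  -- both velocities lie in `𝔤_b`, so that the commutator of their matrices is the bracket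
  have had : k.ad (k.bodyVelocity (hv ε t) Ht) *ᵥ k.bodyVelocity (hv ε t) He =
      k.inclᵀ *ᵥ vee (G * Ht * (G * He) - G * He * (G * Ht)) := by
    rw [← hE, ← hT, ← hat_ad_mulVec, vee_hat, ← k.incl_ad, k.incl_transpose_mulVec_incl]
  rw [h2.deriv, had, ← Matrix.mulVec_add, ← vee_add]
  convert h1 using 3
  noncomm_ring

/-! ### The exponential of a unit joint twist -/

/-- A solution of `g' = A g`, `g 0 = 1` is the one-parameter group of `A`. -/
theorem exp_smul_eq_of_hasDerivAt {𝔸 : Type*} [NormedRing 𝔸] [NormedAlgebra ℝ 𝔸]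
    [CompleteSpace 𝔸] (A : 𝔸) (g : ℝ → 𝔸) (h0 : g 0 = 1)
    (hg : ∀ t, HasDerivAt g (A * g t) t) (t : ℝ) : NormedSpace.exp (t • A) = g t := by
  let _ : NormedAlgebra ℚ 𝔸 := NormedAlgebra.restrictScalars ℚ ℝ 𝔸
  have hd : ∀ t : ℝ, HasDerivAt (fun s : ℝ => NormedSpace.exp (s • (-A)) * g s) 0 t := fun t => by
    have := (hasDerivAt_exp_smul_const (𝕂 := ℝ) (-A) t).mul (hg t)
    rwa [mul_neg, neg_mul, mul_assoc, neg_add_cancel] at this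
  have hc := is_const_of_deriv_eq_zero (fun t => (hd t).differentiableAt) (fun t => (hd t).deriv) t 0
  simp only [zero_smul, NormedSpace.exp_zero, h0, mul_one] at hc
  have hinv : NormedSpace.exp (t • A) * NormedSpace.exp (t • (-A)) = 1 := by
    rw [← NormedSpace.exp_add_of_commute (by simp [Commute, SemiconjBy])]
    simp [NormedSpace.exp_zero]
  calc NormedSpace.exp (t • A) = NormedSpace.exp (t • A) * (NormedSpace.exp (t • (-A)) * g t) := by
        rw [hc, mul_one]
    _ = g t := by rw [← mul_assoc, hinv, one_mul]

/-- Rodrigues' formula. -/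
theorem exp_smul_eq_of_cube {𝔸 : Type*} [NormedRing 𝔸] [NormedAlgebra ℝ 𝔸]
    [CompleteSpace 𝔸] (A : 𝔸) (hA : A * (A * A) = -A) (t : ℝ) :
    NormedSpace.exp (t • A) = 1 + Real.sin t • A + (1 - Real.cos t) • (A * A) := by
  refine exp_smul_eq_of_hasDerivAt A
    (fun t => 1 + Real.sin t • A + (1 - Real.cos t) • (A * A)) (by simp) (fun t => ?_) t
  have h := (((Real.hasDerivAt_sin t).smul_const A).const_add 1).add
    (((Real.hasDerivAt_cos t).const_sub 1).smul_const (A * A))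
  refine h.congr_deriv ?_
  simp only [mul_add, mul_one, mul_smul_comm, hA]
  module

theorem exp_smul_eq_of_sq {𝔸 : Type*} [NormedRing 𝔸] [NormedAlgebra ℝ 𝔸]
    [CompleteSpace 𝔸] (A : 𝔸) (hA : A * A = 0) (t : ℝ) :
    NormedSpace.exp (t • A) = 1 + t • A := by
  refine exp_smul_eq_of_hasDerivAt A (fun t => 1 + t • A) (by simp) (fun t => ?_) t
  have h := ((hasDerivAt_id t).smul_const A).const_add 1
  refine h.congr_deriv ?_
  simp [mul_add, hA]

open scoped Matrix.Norms.Operator in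
theorem matrix_exp_smul_eq_of_cube (A : Matrix Hom Hom ℝ) (hA : A * (A * A) = -A) (t : ℝ) :
    NormedSpace.exp (t • A) = 1 + Real.sin t • A + (1 - Real.cos t) • (A * A) :=
  exp_smul_eq_of_cube A hA t

open scoped Matrix.Norms.Operator in
theorem matrix_exp_smul_eq_of_sq (A : Matrix Hom Hom ℝ) (hA : A * A = 0) (t : ℝ) :
    NormedSpace.exp (t • A) = 1 + t • A :=
  exp_smul_eq_of_sq A hA t

theorem hat_revolute_cube {ω : Fin 3 → ℝ} (hω : ω ⬝ᵥ ω = 1) (x : Fin 3 → ℝ) :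
    hat (Sum.elim ω (crossProduct x ω)) * (hat (Sum.elim ω (crossProduct x ω)) *
      hat (Sum.elim ω (crossProduct x ω))) = -hat (Sum.elim ω (crossProduct x ω)) := by
  simp only [dotProduct, Fin.sum_univ_three] at hω
  ext i j
  rcases i with i | i <;> rcases j with j | j <;> fin_cases i <;> fin_cases j <;>
    simp [hat, skew, Matrix.mul_apply, Fin.sum_univ_three, cross_apply] <;> grind

theorem hat_prismatic_sq (ω : Fin 3 → ℝ) :
    hat (Sum.elim 0 ω) * hat (Sum.elim 0 ω) = 0 := by
  ext i j
  rcases i with i | i <;> rcases j with j | j <;> fin_cases i <;> fin_cases j <;>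
    simp [hat, skew, Matrix.mul_apply, Fin.sum_univ_three]

/-! ### Smoothness of the forward kinematics -/

/-- For a revolute joint the principal representative of the angle, on which `Joint.pose` is
defined, jumps; by Rodrigues' formula the pose depends on its sine and cosine only. -/
theorem Joint.contDiff_pose {r : WithTop ℕ∞} (j : Joint) (a b : Hom) :
    ContDiff ℝ r fun x => j.pose (j.kind.proj x) a b := by
  have h : ∀ c d, ContDiff ℝ r fun x =>
      NormedSpace.exp (j.kind.coord (j.kind.proj x) • hat j.twist) c d := by
    rcases j with ⟨kind, axis, hax, point, home, hhome⟩
    intro c d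
    cases kind
    · change ContDiff ℝ r fun x : ℝ => NormedSpace.exp ((x : Real.Angle).toReal •
        hat (Sum.elim axis (crossProduct point axis))) c d
      simp only [matrix_exp_smul_eq_of_cube _ (hat_revolute_cube hax point),
        Real.Angle.sin_toReal, Real.Angle.sin_coe, Real.Angle.cos_toReal, Real.Angle.cos_coe,
        Matrix.add_apply, Matrix.smul_apply, smul_eq_mul]
      exact (contDiff_const.add (Real.contDiff_sin.mul contDiff_const)).add
        ((contDiff_const.sub Real.contDiff_cos).mul contDiff_const)
    · change ContDiff ℝ r fun x : ℝ => NormedSpace.exp (x • hat (Sum.elim 0 axis)) c d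
      simp only [matrix_exp_smul_eq_of_sq _ (hat_prismatic_sq axis), Matrix.add_apply,
        Matrix.smul_apply, smul_eq_mul]
      exact contDiff_const.add (contDiff_id.mul contDiff_const)
  exact contDiff_const_mul_apply j.home h a b

theorem Joint.isUnit_det_pose (j : Joint) (q : j.kind.Config) : IsUnit (j.pose q).det := by
  rw [pose, Matrix.det_mul]
  exact (isUnit_det_of_mem_SE3 j.home_mem).mul
    ((Matrix.isUnit_iff_isUnit_det _).1 (Matrix.isUnit_exp _))

theorem JointKind.proj_add (k : JointKind) (x y : ℝ) :
    k.proj (x + y) = k.proj x + k.proj y := by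
  cases k
  · exact Real.Angle.coe_add x y
  · rfl

theorem Joint.twist_ne_zero (j : Joint) : j.twist ≠ 0 := by
  intro h
  have hax : j.axis = 0 := by
    rcases j with ⟨kind, axis, hax, point, home, hhome⟩
    cases kind
    · ext i
      exact congrFun h (Sum.inl i)
    · ext i
      exact congrFun h (Sum.inr i)
  have := j.axis_unit
  simp [hax] at this

section Ad

variable {E : Type*} [NormedAddCommGroup E] [NormedSpace ℝ E] {r : WithTop ℕ∞}

theorem contDiff_Ad {H : E → Matrix Hom Hom ℝ} (hH : ∀ i j, ContDiff ℝ r fun x => H x i j)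
    (i j : Six) : ContDiff ℝ r fun x => Ad (H x) i j := by
  rcases i with i | i <;> rcases j with j | j
  · exact hH _ _
  · exact contDiff_const
  · refine contDiff_mul_apply (A := fun x => skew fun i => H x (Sum.inl i) (Sum.inr 0))
      (B := fun x => (H x).toBlocks₁₁) (fun a b => ?_) (fun _ _ => hH _ _) i j
    fin_cases a <;> fin_cases b <;>
      first | exact contDiff_const | exact hH _ _ | exact (hH _ _).neg
  · exact hH _ _

end Ad

theorem Ad_one : Ad 1 = 1 := by
  ext i j
  rcases i with i | i <;> rcases j with j | j <;> fin_cases i <;> fin_cases j <;>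
    simp [Ad, skew, Matrix.toBlocks₁₁, Matrix.one_apply]

namespace VMS

variable {n : ℕ} (S : VMS n)

theorem proj_add (x y : Fin n → ℝ) : S.proj (x + y) = S.proj x + S.proj y :=
  funext fun i => (S.joint i).kind.proj_add (x i) (y i)

theorem isUnit_det_posesUpTo (q : S.Qm) (k : ℕ) : IsUnit (S.posesUpTo q k).det := by
  induction k with
  | zero => simp [posesUpTo]
  | succ k ih =>
    rw [posesUpTo]
    split_ifs with hk
    · rw [Matrix.det_mul]
      exact ih.mul ((S.joint _).isUnit_det_pose _)
    · exact ih

variable {r : WithTop ℕ∞}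

theorem contDiff_posesUpTo (k : ℕ) (a b : Hom) :
    ContDiff ℝ r fun u : Fin n → ℝ => S.posesUpTo (S.proj u) k a b := by
  induction k generalizing a b with
  | zero => exact contDiff_const
  | succ k ih =>
    simp only [posesUpTo]
    split_ifs with hk
    · exact contDiff_mul_apply ih
        (fun c d => ((S.joint ⟨k, hk⟩).contDiff_pose c d).comp (contDiff_apply ℝ ℝ _)) a b
    · exact ih a b

theorem contDiff_linkPose_inv (i : Fin n) (a b : Hom) :
    ContDiff ℝ r fun u : Fin n → ℝ => (S.linkPose (S.proj u) i)⁻¹ a b :=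
  contDiff_inv_apply (S.contDiff_posesUpTo _) (fun _ => S.isUnit_det_posesUpTo _ _) a b

theorem contDiff_jacobian (i : Fin n) (a : Six) (j : Fin n) :
    ContDiff ℝ r fun u : Fin n → ℝ => S.jacobian (S.proj u) i a j := by
  simp only [jacobian, Matrix.of_apply]
  split_ifs
  · exact contDiff_mulVec_apply (v := fun _ => (S.joint j).twist)
      (contDiff_Ad (contDiff_mul_apply (S.contDiff_linkPose_inv i) (S.contDiff_posesUpTo (j + 1))))
      (fun _ => contDiff_const) a
  · exact contDiff_const

theorem contDiff_adBaseToLink (i : Fin n) (a b : Six) :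
    ContDiff ℝ r fun u : Fin n → ℝ => S.adBaseToLink (S.proj u) i a b :=
  contDiff_Ad (S.contDiff_linkPose_inv i) a b

theorem contDiff_massB (a b : S.B) :
    ContDiff ℝ r fun u : Fin n → ℝ => S.massB (S.proj u) a b := by
  refine contDiff_mul_const_apply S.base.incl (contDiff_const_mul_apply S.base.inclᵀ
    fun c d => ?_) a b
  simp only [Matrix.add_apply, Matrix.sum_apply]
  exact contDiff_const.add (ContDiff.sum fun i _ => contDiff_mul_apply
    (A := fun u => (S.adBaseToLink (S.proj u) i)ᵀ * S.linkInertia i)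
    (contDiff_mul_const_apply (S.linkInertia i) fun c d => S.contDiff_adBaseToLink i d c)
    (S.contDiff_adBaseToLink i) c d)

theorem contDiff_massBM (a : S.B) (b : Fin n) :
    ContDiff ℝ r fun u : Fin n → ℝ => S.massBM (S.proj u) a b := by
  simp only [massBM, Matrix.sum_apply]
  exact ContDiff.sum fun i _ => contDiff_mul_apply
    (A := fun u => S.base.inclᵀ * (S.adBaseToLink (S.proj u) i)ᵀ * S.linkInertia i)
    (contDiff_mul_const_apply (S.linkInertia i) (contDiff_const_mul_apply S.base.inclᵀ
      fun c d => S.contDiff_adBaseToLink i d c)) (S.contDiff_jacobian i) a b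

theorem contDiff_massM (a b : Fin n) :
    ContDiff ℝ r fun u : Fin n → ℝ => S.massM (S.proj u) a b := by
  simp only [massM, Matrix.sum_apply]
  exact ContDiff.sum fun i _ => contDiff_mul_apply
    (A := fun u => (S.jacobian (S.proj u) i)ᵀ * S.linkInertia i)
    (contDiff_mul_const_apply (S.linkInertia i) fun c d => S.contDiff_jacobian i d c)
    (S.contDiff_jacobian i) a b

theorem contDiff_mass (a b : S.B ⊕ Fin n) :
    ContDiff ℝ r fun u : Fin n → ℝ => S.mass (S.proj u) a b := by
  rcases a with a | a <;> rcases b with b | b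
  · exact S.contDiff_massB a b
  · exact S.contDiff_massBM a b
  · exact S.contDiff_massBM b a
  · exact S.contDiff_massM a b

/-! ### The mass matrix is positive definite -/

theorem isHermitian_mass (q : S.Qm) : (S.mass q).IsHermitian := by
  have hb : S.baseInertiaᵀ = S.baseInertia := S.baseInertia_posDef.isHermitian
  have hl : ∀ i, (S.linkInertia i)ᵀ = S.linkInertia i := fun i =>
    (S.linkInertia_posDef i).isHermitian
  have hB : (S.massB q)ᵀ = S.massB q := by
    simp only [massB, Matrix.transpose_mul, Matrix.transpose_add, Matrix.transpose_sum,
      Matrix.transpose_transpose, hb, hl, Matrix.mul_assoc]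
  have hM : (S.massM q)ᵀ = S.massM q := by
    simp only [massM, Matrix.transpose_mul, Matrix.transpose_sum,
      Matrix.transpose_transpose, hl, Matrix.mul_assoc]
  change (S.mass q)ᵀ = S.mass q
  rw [mass, Matrix.fromBlocks_transpose, hB, hM, Matrix.transpose_transpose]

theorem dotProduct_transpose_mulVec {l m : Type*} [Fintype l] [Fintype m] (A : Matrix l m ℝ)
    (x : m → ℝ) (y : l → ℝ) : x ⬝ᵥ (Aᵀ *ᵥ y) = (A *ᵥ x) ⬝ᵥ y := by
  rw [Matrix.dotProduct_mulVec, Matrix.vecMul_transpose]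

/-- Twice the kinetic energy is the sum of those of the bodies. -/
theorem dotProduct_mass_mulVec (q : S.Qm) (v : S.B → ℝ) (q' : Fin n → ℝ) :
    Sum.elim v q' ⬝ᵥ (S.mass q *ᵥ Sum.elim v q') =
      (S.base.incl *ᵥ v) ⬝ᵥ (S.baseInertia *ᵥ (S.base.incl *ᵥ v)) +
        ∑ i, (S.adBaseToLink q i *ᵥ (S.base.incl *ᵥ v) + S.jacobian q i *ᵥ q') ⬝ᵥ
          (S.linkInertia i *ᵥ
            (S.adBaseToLink q i *ᵥ (S.base.incl *ᵥ v) + S.jacobian q i *ᵥ q')) := by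
  have hl : ∀ i (x y : Six → ℝ), x ⬝ᵥ (S.linkInertia i *ᵥ y) = y ⬝ᵥ (S.linkInertia i *ᵥ x) :=
    fun i x y => by
      have h : (S.linkInertia i)ᵀ = S.linkInertia i := (S.linkInertia_posDef i).isHermitian
      conv_lhs => rw [← h, dotProduct_transpose_mulVec, dotProduct_comm]
  have hBM : v ⬝ᵥ (S.massBM q *ᵥ q') = ∑ i, (S.adBaseToLink q i *ᵥ (S.base.incl *ᵥ v)) ⬝ᵥ
      (S.linkInertia i *ᵥ (S.jacobian q i *ᵥ q')) := by
    simp only [massBM, Matrix.sum_mulVec, dotProduct_sum, ← Matrix.mulVec_mulVec,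
      dotProduct_transpose_mulVec]
  rw [mass, Matrix.fromBlocks_mulVec, sumElim_dotProduct_sumElim]
  simp only [Sum.elim_comp_inl, Sum.elim_comp_inr, dotProduct_add, dotProduct_transpose_mulVec]
  rw [dotProduct_comm (S.massBM q *ᵥ q') v, hBM, massB, massM]
  simp only [Matrix.sum_mulVec, dotProduct_sum, ← Matrix.mulVec_mulVec, Matrix.add_mulVec,
    dotProduct_transpose_mulVec, dotProduct_add, Matrix.mulVec_add, add_dotProduct,
    Finset.sum_add_distrib]
  rw [Finset.sum_congr rfl fun i _ =>
    hl i (S.jacobian q i *ᵥ q') (S.adBaseToLink q i *ᵥ (S.base.incl *ᵥ v))]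
  ring

/-- The joint velocities are determined by the velocities of the links: the Jacobian of the first
moving link has a single nonzero contribution, its unit joint twist. -/
theorem eq_zero_of_jacobian_mulVec (q : S.Qm) (q' : Fin n → ℝ)
    (h : ∀ i, S.jacobian q i *ᵥ q' = 0) : q' = 0 := by
  ext i
  induction i using WellFoundedLT.induction with
  | ind i ih =>
    have h1 : S.jacobian q i *ᵥ q' = q' i • (S.joint i).twist := by
      ext r
      rw [Matrix.mulVec, dotProduct, Finset.sum_eq_single i]
      · simp only [jacobian, Matrix.of_apply, le_refl, if_true]
        rw [linkPose, Matrix.nonsing_inv_mul _ (S.isUnit_det_posesUpTo q _), Ad_one, Matrix.one_mulVec,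
          Pi.smul_apply, smul_eq_mul, mul_comm]
      · intro j _ hj
        rcases lt_or_gt_of_ne hj with hj | hj
        · simp [ih j hj]
        · simp [jacobian, not_le.2 hj]
      · simp
    rw [h i] at h1
    exact (smul_eq_zero.1 h1.symm).resolve_right (S.joint i).twist_ne_zero

theorem posDef_mass (q : S.Qm) : (S.mass q).PosDef := by
  refine Matrix.PosDef.of_dotProduct_mulVec_pos (S.isHermitian_mass q) fun z hz => ?_
  obtain ⟨v, q', rfl⟩ : ∃ v q', z = Sum.elim v q' := ⟨_, _, (Sum.elim_comp_inl_inr z).symm⟩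
  have hnn : ∀ i (x : Six → ℝ), 0 ≤ x ⬝ᵥ (S.linkInertia i *ᵥ x) := fun i x => by
    simpa using (S.linkInertia_posDef i).posSemidef.dotProduct_mulVec_nonneg x
  rw [star_trivial, dotProduct_mass_mulVec]
  by_cases hv : v = 0
  · subst hv
    have hq : q' ≠ 0 := by
      rintro rfl
      exact hz (by ext i; rcases i with i | i <;> rfl)
    obtain ⟨i, hi⟩ : ∃ i, S.jacobian q i *ᵥ q' ≠ 0 := by
      by_contra! hc
      exact hq (S.eq_zero_of_jacobian_mulVec q q' hc)
    simp only [Matrix.mulVec_zero, dotProduct_zero, zero_add]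
    exact Finset.sum_pos' (fun i _ => hnn i _)
      ⟨i, Finset.mem_univ i, by simpa using (S.linkInertia_posDef i).dotProduct_mulVec_pos hi⟩
  · refine add_pos_of_pos_of_nonneg ?_ (Finset.sum_nonneg fun i _ => hnn i _)
    have : S.base.incl *ᵥ v ≠ 0 := fun h =>
      hv (S.base.incl_mulVec_injective (h.trans (Matrix.mulVec_zero _).symm))
    simpa using S.baseInertia_posDef.dotProduct_mulVec_pos this

end VMS

/-! ### Derivatives of quadratic forms -/

theorem dotProduct_apply_single {ι : Type*} [Fintype ι] [DecidableEq ι] (f : (ι → ℝ) →L[ℝ] ℝ)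
    (x : ι → ℝ) : (fun i => f (Pi.single i 1)) ⬝ᵥ x = f x := by
  conv_rhs => rw [pi_eq_sum_univ' x, map_sum]
  refine Finset.sum_congr rfl fun i _ => ?_
  rw [map_smul, smul_eq_mul, mul_comm]

theorem fderiv_apply_eq_of_hasDerivAt {E : Type*} [NormedAddCommGroup E] [NormedSpace ℝ E]
    {f : E → ℝ} {x e : E} {d : ℝ} (hf : DifferentiableAt ℝ f x)
    (h : HasDerivAt (fun s : ℝ => f (x + s • e)) d 0) : fderiv ℝ f x e = d :=
  (hf.hasFDerivAt.hasLineDerivAt e).unique h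

theorem dotProduct_mulVec_comm {κ : Type*} [Fintype κ] {M : Matrix κ κ ℝ} (hM : Mᵀ = M)
    (x y : κ → ℝ) : x ⬝ᵥ (M *ᵥ y) = (M *ᵥ x) ⬝ᵥ y := by
  rw [Matrix.dotProduct_mulVec, ← Matrix.mulVec_transpose, hM]

theorem hasDerivAt_quadraticForm {κ : Type*} [Fintype κ] {M : Matrix κ κ ℝ} (hM : Mᵀ = M)
    (z e : κ → ℝ) :
    HasDerivAt (fun s : ℝ => (1 / 2) * ((z + s • e) ⬝ᵥ (M *ᵥ (z + s • e)))) (e ⬝ᵥ (M *ᵥ z)) 0 := by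
  have h1 : ∀ s : ℝ, (1 / 2) * ((z + s • e) ⬝ᵥ (M *ᵥ (z + s • e))) =
      (1 / 2) * (z ⬝ᵥ (M *ᵥ z)) + (s * (e ⬝ᵥ (M *ᵥ z)) + s ^ 2 * ((1 / 2) * (e ⬝ᵥ (M *ᵥ e)))) := by
    intro s
    have h2 : z ⬝ᵥ (M *ᵥ e) = e ⬝ᵥ (M *ᵥ z) := by
      rw [dotProduct_mulVec_comm hM, dotProduct_comm]
    simp only [Matrix.mulVec_add, Matrix.mulVec_smul, dotProduct_add, add_dotProduct,
      smul_dotProduct, dotProduct_smul, smul_eq_mul, h2]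
    ring
  simp only [h1]
  have h3 := (((hasDerivAt_id (0 : ℝ)).mul_const (e ⬝ᵥ (M *ᵥ z))).add
    ((hasDerivAt_pow 2 (0 : ℝ)).mul_const ((1 / 2) * (e ⬝ᵥ (M *ᵥ e))))).const_add
      ((1 / 2) * (z ⬝ᵥ (M *ᵥ z)))
  refine h3.congr_deriv ?_
  simp

theorem hasDerivAt_dotProduct_mulVec {κ μ : Type*} [Fintype κ] [Fintype μ]
    {A : ℝ → Matrix κ μ ℝ} {A' : Matrix κ μ ℝ} {t : ℝ}
    (hA : ∀ i j, HasDerivAt (fun s => A s i j) (A' i j) t) (x : κ → ℝ) (y : μ → ℝ) :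
    HasDerivAt (fun s => x ⬝ᵥ (A s *ᵥ y)) (x ⬝ᵥ (A' *ᵥ y)) t := by
  simp only [dotProduct, Matrix.mulVec]
  exact HasDerivAt.fun_sum fun i _ => (HasDerivAt.fun_sum fun j _ =>
    (hA i j).mul_const (y j)).const_mul (x i)

theorem contDiff_sumElim_apply {E κ μ : Type*} [NormedAddCommGroup E] [NormedSpace ℝ E]
    [Fintype κ] [Fintype μ] {r : WithTop ℕ∞} {f : E → κ → ℝ} {g : E → μ → ℝ}
    (hf : ContDiff ℝ r f) (hg : ContDiff ℝ r g) (i : κ ⊕ μ) :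
    ContDiff ℝ r fun x => Sum.elim (f x) (g x) i := by
  rcases i with i | i
  · exact contDiff_pi.1 hf i
  · exact contDiff_pi.1 hg i

namespace VMS

variable {n : ℕ} (S : VMS n) {r : WithTop ℕ∞}

/-! ### The momenta and the Legendre transformation -/

theorem transpose_mass (q : S.Qm) : (S.mass q)ᵀ = S.mass q := S.isHermitian_mass q

theorem isUnit_det_mass (q : S.Qm) : IsUnit (S.mass q).det :=
  (Matrix.isUnit_iff_isUnit_det _).1 (S.posDef_mass q).isUnit

theorem transpose_inv_mass (q : S.Qm) : ((S.mass q)⁻¹)ᵀ = (S.mass q)⁻¹ := by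
  rw [Matrix.transpose_nonsing_inv, S.transpose_mass]

theorem sumElim_add_smul_left {κ μ : Type*} (x e : κ → ℝ) (y : μ → ℝ) (s : ℝ) :
    Sum.elim (x + s • e) y = Sum.elim x y + s • Sum.elim e (0 : μ → ℝ) := by
  ext i
  rcases i with i | i <;> simp

theorem sumElim_add_smul_right {κ μ : Type*} (x : κ → ℝ) (y e : μ → ℝ) (s : ℝ) :
    Sum.elim x (y + s • e) = Sum.elim x y + s • Sum.elim (0 : κ → ℝ) e := by
  ext i
  rcases i with i | i <;> simp

/-- The partial gradients of a quadratic form on a product. -/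
theorem fderiv_quadraticForm_left {κ μ : Type*} [Fintype κ] [Fintype μ] [DecidableEq κ]
    {M : Matrix (κ ⊕ μ) (κ ⊕ μ) ℝ} (hM : Mᵀ = M) (x : κ → ℝ) (y : μ → ℝ) (i : κ) :
    fderiv ℝ (fun x₁ => (1 / 2) * (Sum.elim x₁ y ⬝ᵥ (M *ᵥ Sum.elim x₁ y))) x (Pi.single i 1) =
      (M *ᵥ Sum.elim x y) (Sum.inl i) := by
  refine fderiv_apply_eq_of_hasDerivAt ?_ ?_
  · have hc : ∀ j, ContDiff ℝ 1 fun x₁ : κ → ℝ => Sum.elim x₁ y j :=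
      contDiff_sumElim_apply contDiff_id contDiff_const
    exact (contDiff_const.mul (contDiff_dotProduct hc (contDiff_mulVec_apply
      (A := fun _ => M) (fun _ _ => contDiff_const) hc))).differentiable one_ne_zero x
  · simp only [sumElim_add_smul_left]
    refine (hasDerivAt_quadraticForm hM _ _).congr_deriv ?_
    simp [dotProduct, Pi.single_apply]

theorem fderiv_quadraticForm_right {κ μ : Type*} [Fintype κ] [Fintype μ] [DecidableEq μ]
    {M : Matrix (κ ⊕ μ) (κ ⊕ μ) ℝ} (hM : Mᵀ = M) (x : κ → ℝ) (y : μ → ℝ) (i : μ) :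
    fderiv ℝ (fun y₁ => (1 / 2) * (Sum.elim x y₁ ⬝ᵥ (M *ᵥ Sum.elim x y₁))) y (Pi.single i 1) =
      (M *ᵥ Sum.elim x y) (Sum.inr i) := by
  refine fderiv_apply_eq_of_hasDerivAt ?_ ?_
  · have hc : ∀ j, ContDiff ℝ 1 fun y₁ : μ → ℝ => Sum.elim x y₁ j :=
      contDiff_sumElim_apply contDiff_const contDiff_id
    exact (contDiff_const.mul (contDiff_dotProduct hc (contDiff_mulVec_apply
      (A := fun _ => M) (fun _ _ => contDiff_const) hc))).differentiable one_ne_zero y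
  · simp only [sumElim_add_smul_right]
    refine (hasDerivAt_quadraticForm hM _ _).congr_deriv ?_
    simp [dotProduct, Pi.single_apply]

theorem elim_momenta (v : S.B → ℝ) (q : S.Qm) (q' : Fin n → ℝ) :
    Sum.elim (S.baseMomentum v q q') (S.jointMomentum v q q') = S.mass q *ᵥ Sum.elim v q' := by
  ext i
  rcases i with i | i
  · exact fderiv_quadraticForm_left (S.transpose_mass q) v q' i
  · exact fderiv_quadraticForm_right (S.transpose_mass q) v q' i

theorem momenta_eq (v : S.B → ℝ) (q : S.Qm) (q' : Fin n → ℝ) :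
    S.baseMomentum v q q' = S.massB q *ᵥ v + S.massBM q *ᵥ q' ∧
      S.jointMomentum v q q' = (S.massBM q)ᵀ *ᵥ v + S.massM q *ᵥ q' := by
  have h := S.elim_momenta v q q'
  rw [mass, Matrix.fromBlocks_mulVec, Sum.elim_comp_inl, Sum.elim_comp_inr] at h
  exact ⟨funext fun i => congrFun h (Sum.inl i), funext fun i => congrFun h (Sum.inr i)⟩

theorem inv_mass_mulVec_momenta (v : S.B → ℝ) (q : S.Qm) (q' : Fin n → ℝ) :
    (S.mass q)⁻¹ *ᵥ Sum.elim (S.baseMomentum v q q') (S.jointMomentum v q q') =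
      Sum.elim v q' := by
  rw [elim_momenta, Matrix.mulVec_mulVec, Matrix.nonsing_inv_mul _ (S.isUnit_det_mass q),
    Matrix.one_mulVec]

theorem momenta_eq_iff (v : S.B → ℝ) (q : S.Qm) (q' : Fin n → ℝ) (p : S.B → ℝ) (π : Fin n → ℝ) :
    (p = S.baseMomentum v q q' ∧ π = S.jointMomentum v q q') ↔
      Sum.elim v q' = (S.mass q)⁻¹ *ᵥ Sum.elim p π := by
  constructor
  · rintro ⟨rfl, rfl⟩
    rw [inv_mass_mulVec_momenta]
  · intro h
    have h1 := S.elim_momenta v q q'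
    rw [h, Matrix.mulVec_mulVec, Matrix.mul_nonsing_inv _ (S.isUnit_det_mass q),
      Matrix.one_mulVec] at h1
    exact ⟨funext fun i => (congrFun h1 (Sum.inl i)).symm,
      funext fun i => (congrFun h1 (Sum.inr i)).symm⟩

theorem isLegendreTransform_hamiltonian : S.IsLegendreTransform S.hamiltonian := by
  refine fun q => ⟨⟨fun z z' h => ?_, fun x => ?_⟩, fun v q' => ?_⟩
  · have h1 := S.inv_mass_mulVec_momenta z.1 q z.2
    rw [(Prod.mk.inj h).1, (Prod.mk.inj h).2, inv_mass_mulVec_momenta] at h1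
    exact Prod.ext (funext fun i => (congrFun h1 (Sum.inl i)).symm)
      (funext fun i => (congrFun h1 (Sum.inr i)).symm)
  · have h1 := (S.momenta_eq_iff _ q _ x.1 x.2).2
      (Sum.elim_comp_inl_inr ((S.mass q)⁻¹ *ᵥ Sum.elim x.1 x.2))
    exact ⟨(_, _), Prod.ext h1.1.symm h1.2.symm⟩
  · rw [hamiltonian, inv_mass_mulVec_momenta, ← sumElim_dotProduct_sumElim, elim_momenta,
      lagrangian, dotProduct_comm (Sum.elim v q')]
    ring

theorem contDiff_hamiltonian : ContDiff ℝ r fun y : (S.B → ℝ) × (Fin n → ℝ) × (Fin n → ℝ) =>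
    S.hamiltonian (y.1, S.proj y.2.1, y.2.2) := by
  have hc := contDiff_sumElim_apply (r := r)
    (contDiff_fst : ContDiff ℝ r fun y : (S.B → ℝ) × (Fin n → ℝ) × (Fin n → ℝ) => y.1)
    (contDiff_snd.comp contDiff_snd)
  exact contDiff_const.mul (contDiff_dotProduct hc (contDiff_mulVec_apply (contDiff_inv_apply
    (fun a b => (S.contDiff_mass a b).comp (contDiff_fst.comp contDiff_snd))
    fun _ => S.isUnit_det_mass _) hc))

/-- The reduced Lagrangian pulled back along the covering map `ℝⁿ → Q_m`. -/
noncomputable def lagrangianLift (y : (S.B → ℝ) × (Fin n → ℝ) × (Fin n → ℝ)) : ℝ :=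
  S.lagrangian y.1 (S.proj y.2.1) y.2.2

theorem contDiff_lagrangianLift : ContDiff ℝ r S.lagrangianLift := by
  have hc := contDiff_sumElim_apply (r := r)
    (contDiff_fst : ContDiff ℝ r fun y : (S.B → ℝ) × (Fin n → ℝ) × (Fin n → ℝ) => y.1)
    (contDiff_snd.comp contDiff_snd)
  exact contDiff_const.mul (contDiff_dotProduct hc (contDiff_mulVec_apply
    (fun a b => (S.contDiff_mass a b).comp (contDiff_fst.comp contDiff_snd)) hc))

/-- The generalized force `∂L/∂q`, along the coordinate directions of the group `Q_m`. -/
noncomputable def jointForce (v : S.B → ℝ) (q : S.Qm) (q' : Fin n → ℝ) : Fin n → ℝ :=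
  fun i => fderiv ℝ (fun δ => S.lagrangian v (q + S.proj δ) q') 0 (Pi.single i 1)

theorem fderiv_lagrangianLift (v : S.B → ℝ) (u q' : Fin n → ℝ)
    (δ : (S.B → ℝ) × (Fin n → ℝ) × (Fin n → ℝ)) :
    fderiv ℝ S.lagrangianLift (v, u, q') δ =
      S.baseMomentum v (S.proj u) q' ⬝ᵥ δ.1 + S.jointForce v (S.proj u) q' ⬝ᵥ δ.2.1 +
        S.jointMomentum v (S.proj u) q' ⬝ᵥ δ.2.2 := by
  set L := S.lagrangianLift
  have hd : HasFDerivAt L (fderiv ℝ L (v, u, q')) (v, u, q') :=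
    ((S.contDiff_lagrangianLift (r := 1)).differentiable one_ne_zero _).hasFDerivAt
  have h1 : HasFDerivAt (fun v₁ => S.lagrangian v₁ (S.proj u) q')
      ((fderiv ℝ L (v, u, q')).comp ((ContinuousLinearMap.id ℝ _).prod 0)) v :=
    hd.comp (f := fun v₁ => (v₁, u, q')) v ((hasFDerivAt_id v).prodMk (hasFDerivAt_const _ _))
  have h2 : HasFDerivAt (fun δ => S.lagrangian v (S.proj u + S.proj δ) q')
      ((fderiv ℝ L (v, u, q')).comp
        ((0 : (Fin n → ℝ) →L[ℝ] _).prod ((ContinuousLinearMap.id ℝ _).prod 0))) 0 := by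
    simp only [← S.proj_add]
    have h3 : HasFDerivAt (fun δ : Fin n → ℝ => (v, u + δ, q'))
        ((0 : (Fin n → ℝ) →L[ℝ] _).prod ((ContinuousLinearMap.id ℝ _).prod 0)) 0 :=
      (hasFDerivAt_const _ _).prodMk
        (((hasFDerivAt_id _).const_add u).prodMk (hasFDerivAt_const _ _))
    refine HasFDerivAt.comp (g := L) 0 ?_ h3
    rwa [add_zero]
  have h3 : HasFDerivAt (fun q₁ => S.lagrangian v (S.proj u) q₁)
      ((fderiv ℝ L (v, u, q')).comp ((0 : (Fin n → ℝ) →L[ℝ] _).prod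
        ((0 : (Fin n → ℝ) →L[ℝ] _).prod (ContinuousLinearMap.id ℝ _)))) q' :=
    hd.comp (f := fun q₁ => (v, u, q₁)) q'
      ((hasFDerivAt_const _ _).prodMk ((hasFDerivAt_const _ _).prodMk (hasFDerivAt_id q')))
  have e1 : S.baseMomentum v (S.proj u) q' ⬝ᵥ δ.1 = fderiv ℝ L (v, u, q') (δ.1, 0, 0) := by
    refine (dotProduct_apply_single _ _).trans ?_
    rw [h1.fderiv]
    rfl
  have e2 : S.jointForce v (S.proj u) q' ⬝ᵥ δ.2.1 = fderiv ℝ L (v, u, q') (0, δ.2.1, 0) := by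
    refine (dotProduct_apply_single _ _).trans ?_
    rw [h2.fderiv]
    rfl
  have e3 : S.jointMomentum v (S.proj u) q' ⬝ᵥ δ.2.2 = fderiv ℝ L (v, u, q') (0, 0, δ.2.2) := by
    refine (dotProduct_apply_single _ _).trans ?_
    rw [h3.fderiv]
    rfl
  rw [e1, e2, e3]
  rw [← map_add, ← map_add]
  simp

/-! ### The gradient of the Hamiltonian -/

theorem input_transpose_mulVec_sumElim (x : S.B → ℝ) (y z : Fin n → ℝ) :
    S.inputᵀ *ᵥ Sum.elim x (Sum.elim y z) = Sum.elim x z := by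
  rw [input, Matrix.fromBlocks_transpose, Matrix.fromBlocks_mulVec, Matrix.transpose_fromRows,
    Sum.elim_comp_inl, Sum.elim_comp_inr, Matrix.fromCols_mulVec]
  simp

theorem input_transpose_mulVec_grad (F : S.State → ℝ) (x : S.State) :
    S.inputᵀ *ᵥ S.grad F x = Sum.elim (fun i => S.grad F x (Sum.inl i))
      (fun i => S.grad F x (Sum.inr (Sum.inr i))) :=
  S.input_transpose_mulVec_sumElim _ _ _

theorem input_transpose_mulVec_grad_hamiltonian (x : S.State) :
    S.inputᵀ *ᵥ S.grad S.hamiltonian x = (S.mass x.2.1)⁻¹ *ᵥ Sum.elim x.1 x.2.2 := by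
  rw [input_transpose_mulVec_grad]
  ext i
  rcases i with i | i
  · exact fderiv_quadraticForm_left (S.transpose_inv_mass x.2.1) x.1 x.2.2 i
  · exact fderiv_quadraticForm_right (S.transpose_inv_mass x.2.1) x.1 x.2.2 i

/-- The gradient of the Hamiltonian consists of the velocities and of `-∂L/∂q`. The latter holds
since `q ↦ ½ xᵀ M(q)⁻¹ x` and `q ↦ ½ zᵀ M(q) z` have opposite derivatives where `x = M(q) z`. -/
theorem grad_hamiltonian (v : S.B → ℝ) (u q' : Fin n → ℝ) :
    S.grad S.hamiltonian (S.baseMomentum v (S.proj u) q', S.proj u,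
      S.jointMomentum v (S.proj u) q') =
      Sum.elim v (Sum.elim (-S.jointForce v (S.proj u) q') q') := by
  set q := S.proj u with hq
  set P := S.baseMomentum v q q'
  set pj := S.jointMomentum v q q'
  have hinv : (S.mass q)⁻¹ *ᵥ Sum.elim P pj = Sum.elim v q' := S.inv_mass_mulVec_momenta v q q'
  have hgrad := S.input_transpose_mulVec_grad_hamiltonian (P, q, pj)
  rw [input_transpose_mulVec_grad, hinv] at hgrad
  ext i
  rcases i with i | i | i
  · exact congrFun hgrad (Sum.inl i)
  · change fderiv ℝ (fun δ => S.hamiltonian (P, q + S.proj δ, pj)) 0 (Pi.single i 1) =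
      -fderiv ℝ (fun δ => S.lagrangian v (q + S.proj δ) q') 0 (Pi.single i 1)
    simp only [hq, ← S.proj_add]
    set A : ℝ → Matrix (S.B ⊕ Fin n) (S.B ⊕ Fin n) ℝ :=
      fun s => S.mass (S.proj (u + s • Pi.single i 1)) with hA
    have hA0 : A 0 = S.mass q := by simp [hA, hq]
    have hc : ∀ a b, ContDiff ℝ 1 fun s => A s a b := fun a b =>
      (S.contDiff_mass a b).comp (contDiff_const.add (contDiff_id.smul contDiff_const))
    let A' : Matrix (S.B ⊕ Fin n) (S.B ⊕ Fin n) ℝ := Matrix.of fun a b => deriv (fun s => A s a b) 0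
    have hA' : ∀ a b, HasDerivAt (fun s => A s a b) (A' a b) 0 := fun a b =>
      ((hc a b).differentiable one_ne_zero 0).hasDerivAt
    have hL : fderiv ℝ (fun δ => S.lagrangian v (S.proj (u + δ)) q') 0 (Pi.single i 1) =
        (1 / 2) * (Sum.elim v q' ⬝ᵥ (A' *ᵥ Sum.elim v q')) := by
      refine fderiv_apply_eq_of_hasDerivAt ?_ ?_
      · exact ((S.contDiff_lagrangianLift (r := 1)).comp (contDiff_const.prodMk
          ((contDiff_const.add contDiff_id).prodMk contDiff_const))).differentiable one_ne_zero _
      · simp only [zero_add]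
        exact (hasDerivAt_dotProduct_mulVec hA' _ _).const_mul _
    have hH : fderiv ℝ (fun δ => S.hamiltonian (P, S.proj (u + δ), pj)) 0 (Pi.single i 1) =
        (1 / 2) * (Sum.elim P pj ⬝ᵥ (-((A 0)⁻¹ * A' * (A 0)⁻¹) *ᵥ Sum.elim P pj)) := by
      refine fderiv_apply_eq_of_hasDerivAt ?_ ?_
      · exact ((S.contDiff_hamiltonian (r := 1)).comp (contDiff_const.prodMk
          ((contDiff_const.add contDiff_id).prodMk contDiff_const))).differentiable one_ne_zero _
      · simp only [zero_add]
        exact (hasDerivAt_dotProduct_mulVec (hasDerivAt_inv_apply hc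
          (fun _ => S.isUnit_det_mass _) hA') (Sum.elim P pj) (Sum.elim P pj)).const_mul (1 / 2)
    rw [hH, hL, hA0, Matrix.neg_mulVec, dotProduct_neg, ← Matrix.mulVec_mulVec,
      ← Matrix.mulVec_mulVec, dotProduct_mulVec_comm (S.transpose_inv_mass q), hinv, mul_neg]
  · exact congrFun hgrad (Sum.inr i)

end VMS

/-! ### Smoothness of the bracket -/

theorem contDiff_ad_apply {E : Type*} [NormedAddCommGroup E] [NormedSpace ℝ E]
    {r : WithTop ℕ∞} {V : E → Six → ℝ} (hV : ∀ i, ContDiff ℝ r fun x => V x i) (i j : Six) :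
    ContDiff ℝ r fun x => ad (V x) i j := by
  have hs : ∀ {f : E → Fin 3 → ℝ}, (∀ i, ContDiff ℝ r fun x => f x i) → ∀ a b,
      ContDiff ℝ r fun x => skew (f x) a b := fun hf a b => by
    fin_cases a <;> fin_cases b <;>
      first | exact contDiff_const | exact hf _ | exact (hf _).neg
  rcases i with i | i <;> rcases j with j | j
  · exact hs (fun _ => hV _) i j
  · exact contDiff_const
  · exact hs (fun _ => hV _) i j
  · exact hs (fun _ => hV _) i j

theorem BaseKind.contDiff_ad_apply (k : BaseKind) {E : Type*} [NormedAddCommGroup E]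
    [NormedSpace ℝ E] {r : WithTop ℕ∞} {v : E → k.Idx → ℝ} (hv : ContDiff ℝ r v) (i j : k.Idx) :
    ContDiff ℝ r fun x => k.ad (v x) i j :=
  contDiff_mul_const_apply k.incl (contDiff_const_mul_apply k.inclᵀ
    (VehicleManipulator.contDiff_ad_apply (contDiff_mulVec_apply (A := fun _ => k.incl)
      (fun _ _ => contDiff_const) (contDiff_pi.1 hv)))) i j

theorem BaseKind.contDiff_ad_mulVec (k : BaseKind) {E : Type*} [NormedAddCommGroup E]
    [NormedSpace ℝ E] {r : WithTop ℕ∞} {v η : E → k.Idx → ℝ} (hv : ContDiff ℝ r v)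
    (hη : ContDiff ℝ r η) : ContDiff ℝ r fun x => k.ad (v x) *ᵥ η x :=
  contDiff_pi.2 (contDiff_mulVec_apply (k.contDiff_ad_apply hv) (contDiff_pi.1 hη))

namespace VMS

variable {n : ℕ} (S : VMS n)

/-! ### The first variation of the action -/

section Momenta

variable {E : Type*} [NormedAddCommGroup E] [NormedSpace ℝ E] {r : WithTop ℕ∞}
  {v : E → S.B → ℝ} {u u' : E → Fin n → ℝ}

theorem contDiff_fderiv_lagrangianLift (hv : ContDiff ℝ r v) (hu : ContDiff ℝ r u)
    (hu' : ContDiff ℝ r u') (δ : (S.B → ℝ) × (Fin n → ℝ) × (Fin n → ℝ)) :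
    ContDiff ℝ r fun x => fderiv ℝ S.lagrangianLift (v x, u x, u' x) δ :=
  (((S.contDiff_lagrangianLift (r := r + 1)).fderiv_right le_rfl).comp
    (hv.prodMk (hu.prodMk hu'))).clm_apply contDiff_const

theorem contDiff_baseMomentum (hv : ContDiff ℝ r v) (hu : ContDiff ℝ r u)
    (hu' : ContDiff ℝ r u') :
    ContDiff ℝ r fun x => S.baseMomentum (v x) (S.proj (u x)) (u' x) :=
  contDiff_pi.2 fun i => by
    simpa [fderiv_lagrangianLift] using
      S.contDiff_fderiv_lagrangianLift hv hu hu' (Pi.single i 1, 0, 0)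

theorem contDiff_jointForce (hv : ContDiff ℝ r v) (hu : ContDiff ℝ r u)
    (hu' : ContDiff ℝ r u') :
    ContDiff ℝ r fun x => S.jointForce (v x) (S.proj (u x)) (u' x) :=
  contDiff_pi.2 fun i => by
    simpa [fderiv_lagrangianLift] using
      S.contDiff_fderiv_lagrangianLift hv hu hu' (0, Pi.single i 1, 0)

theorem contDiff_jointMomentum (hv : ContDiff ℝ r v) (hu : ContDiff ℝ r u)
    (hu' : ContDiff ℝ r u') :
    ContDiff ℝ r fun x => S.jointMomentum (v x) (S.proj (u x)) (u' x) :=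
  contDiff_pi.2 fun i => by
    simpa [fderiv_lagrangianLift] using
      S.contDiff_fderiv_lagrangianLift hv hu hu' (0, 0, Pi.single i 1)

end Momenta

/-- Differentiation of the action under the integral sign. -/
theorem hasDerivAt_action {y y' : ℝ → ℝ → (S.B → ℝ) × (Fin n → ℝ) × (Fin n → ℝ)}
    (hy : Continuous fun z : ℝ × ℝ => y z.1 z.2) (hy' : Continuous fun z : ℝ × ℝ => y' z.1 z.2)
    (hd : ∀ ε t, HasDerivAt (fun e => y e t) (y' ε t) ε) (a b ε : ℝ) :
    HasDerivAt (fun e => ∫ t in a..b, S.lagrangianLift (y e t))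
      (∫ t in a..b, fderiv ℝ S.lagrangianLift (y ε t) (y' ε t)) ε := by
  have hL := S.contDiff_lagrangianLift (r := 1)
  refine hasDerivAt_intervalIntegral_of_continuous
    (F' := fun ε t => fderiv ℝ S.lagrangianLift (y ε t) (y' ε t)) (hL.continuous.comp hy) ?_ ?_ ε
  · exact ((hL.continuous_fderiv one_ne_zero).comp hy).clm_apply hy'
  · exact fun ε t =>
      (hL.differentiable one_ne_zero (y ε t)).hasFDerivAt.comp_hasDerivAt
        (f := fun e => y e t) ε (hd ε t)

/-- The integrand of the first variation of the action along `(v, q, q̇)` for the variations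
`δv = η̇ + ad_v η` and `δq`. -/
noncomputable def firstVariation (v η : ℝ → S.B → ℝ) (u δq : ℝ → Fin n → ℝ) (t : ℝ) : ℝ :=
  fderiv ℝ S.lagrangianLift (v t, u t, deriv u t)
    (deriv η t + S.base.ad (v t) *ᵥ η t, δq t, deriv δq t)

theorem hasDerivAt_reducedAction {v η : ℝ → S.B → ℝ} {u δq : ℝ → Fin n → ℝ}
    (hv : ContDiff ℝ 1 v) (hu : ContDiff ℝ 2 u) (hη : ContDiff ℝ 1 η) (hδ : ContDiff ℝ 1 δq)
    (a b : ℝ) :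
    HasDerivAt
      (fun ε : ℝ => ∫ t in a..b,
        S.lagrangian (v t + ε • (deriv η t + S.base.ad (v t) *ᵥ η t))
          (S.proj (u t + ε • δq t)) (deriv u t + ε • deriv δq t))
      (∫ t in a..b, S.firstVariation v η u δq t) 0 := by
  have hη' : Continuous (deriv η) := hη.continuous_deriv_one
  have hδ' : Continuous (deriv δq) := hδ.continuous_deriv_one
  have hu' : Continuous (deriv u) := hu.continuous_deriv one_le_two
  have had := (S.base.contDiff_ad_mulVec hv hη).continuous
  have hδy : Continuous fun t => (deriv η t + S.base.ad (v t) *ᵥ η t, δq t, deriv δq t) :=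
    (hη'.add had).prodMk (hδ.continuous.prodMk hδ')
  have key := S.hasDerivAt_action
    (y := fun ε t => (v t, u t, deriv u t) +
      ε • (deriv η t + S.base.ad (v t) *ᵥ η t, δq t, deriv δq t))
    (y' := fun _ t => (deriv η t + S.base.ad (v t) *ᵥ η t, δq t, deriv δq t))
    (((hv.continuous.prodMk (hu.continuous.prodMk hu')).comp continuous_snd).add
      (continuous_fst.smul (hδy.comp continuous_snd)))
    (hδy.comp continuous_snd)
    (fun ε t => (((hasDerivAt_id ε).smul_const
      (deriv η t + S.base.ad (v t) *ᵥ η t, δq t, deriv δq t)).const_add _).congr_deriv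
        (one_smul _ _)) a b 0
  simpa [firstVariation, lagrangianLift] using key

theorem contDiff_baseTwist {h : ℝ → Matrix Hom Hom ℝ} {u : ℝ → Fin n → ℝ}
    (hm : S.IsMotion h u) : ContDiff ℝ 1 (S.baseTwist h) :=
  S.base.contDiff_bodyVelocity hm.mem (fun i j => (hm.contDiff_base i j).of_le one_le_two)
    fun i j => ((contDiff_succ_iff_deriv (n := 1)).1 (hm.contDiff_base i j)).2.2

/-- Along a variation of the motion the velocities change as in the reduced principle, by the
Maurer–Cartan relation, so that both principles have the same first variation. -/
theorem hasDerivAt_fullAction {h : ℝ → Matrix Hom Hom ℝ} {u : ℝ → Fin n → ℝ}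
    {hv : ℝ → ℝ → Matrix Hom Hom ℝ} {uv : ℝ → ℝ → Fin n → ℝ}
    (hmem : ∀ ε t, hv ε t ∈ S.base.group)
    (hc : ∀ i j, ContDiff ℝ 2 fun z : ℝ × ℝ => hv z.1 z.2 i j)
    (huc : ContDiff ℝ 2 fun z : ℝ × ℝ => uv z.1 z.2)
    (h0 : ∀ t, hv 0 t = h t ∧ uv 0 t = u t) (a b : ℝ) :
    HasDerivAt
      (fun ε => ∫ t in a..b,
        S.fullLagrangian (hv ε t) (matDeriv (hv ε) t) (S.proj (uv ε t)) (deriv (uv ε) t))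
      (∫ t in a..b, S.firstVariation (S.baseTwist h)
        (fun t => S.base.bodyVelocity (h t) (matDeriv (fun ε => hv ε t) 0)) u
        (fun t => deriv (fun ε => uv ε t) 0) t) 0 := by
  have hone : (1 : WithTop ℕ∞) + 1 ≤ 2 := by norm_num
  have hv1 : ContDiff ℝ 1 fun z : ℝ × ℝ =>
      S.base.bodyVelocity (hv z.1 z.2) (matDeriv (hv z.1) z.2) :=
    S.base.contDiff_bodyVelocity (fun z => hmem z.1 z.2) (fun i j => (hc i j).of_le one_le_two)
      fun i j => contDiff_deriv_right (hc i j) hone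
  have hη1 : ContDiff ℝ 1 fun z : ℝ × ℝ =>
      S.base.bodyVelocity (hv z.1 z.2) (matDeriv (fun e => hv e z.2) z.1) :=
    S.base.contDiff_bodyVelocity (fun z => hmem z.1 z.2) (fun i j => (hc i j).of_le one_le_two)
      fun i j => contDiff_deriv_left (hc i j) hone
  have hδ1 := contDiff_deriv_left huc hone
  have key := S.hasDerivAt_action
    (y := fun ε t => (S.base.bodyVelocity (hv ε t) (matDeriv (hv ε) t), uv ε t, deriv (uv ε) t))
    (y' := fun ε t =>
      (deriv (fun s => S.base.bodyVelocity (hv ε s) (matDeriv (fun e => hv e s) ε)) t +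
        S.base.ad (S.base.bodyVelocity (hv ε t) (matDeriv (hv ε) t)) *ᵥ
          S.base.bodyVelocity (hv ε t) (matDeriv (fun e => hv e t) ε),
        deriv (fun e => uv e t) ε, deriv (fun s => deriv (fun e => uv e s) ε) t))
    (hv1.continuous.prodMk (huc.continuous.prodMk (contDiff_deriv_right huc hone).continuous))
    (((contDiff_deriv_right (m := 0) hη1 (by norm_num)).continuous.add
      (S.base.contDiff_ad_mulVec hv1 hη1).continuous).prodMk
      (hδ1.continuous.prodMk (contDiff_deriv_right (m := 0) hδ1 (by norm_num)).continuous))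
    (fun ε t => (S.base.hasDerivAt_bodyVelocity hmem hc ε t).prodMk
      (((((huc.comp (contDiff_id.prodMk contDiff_const)).differentiable
        two_ne_zero) ε).hasDerivAt).prodMk (hasDerivAt_deriv_comm huc ε t))) a b 0
  have hh : hv 0 = h := funext fun t => (h0 t).1
  have hu : uv 0 = u := funext fun t => (h0 t).2
  simp only [hh, hu] at key
  exact key

/-! ### The Euler–Lagrange equations -/

/-- The Euler–Poincaré equation of the base together with the Euler–Lagrange equation of the
joints, both with external forces. -/
def EulerLagrange (a b : ℝ) (v : ℝ → S.B → ℝ) (u : ℝ → Fin n → ℝ) (w : ℝ → S.B → ℝ)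
    (τ : ℝ → Fin n → ℝ) : Prop :=
  ∀ t ∈ Set.Icc a b,
    (S.base.ad (v t))ᵀ *ᵥ S.baseMomentum (v t) (S.proj (u t)) (deriv u t) + w t =
      deriv (fun s => S.baseMomentum (v s) (S.proj (u s)) (deriv u s)) t ∧
    S.jointForce (v t) (S.proj (u t)) (deriv u t) + τ t =
      deriv (fun s => S.jointMomentum (v s) (S.proj (u s)) (deriv u s)) t

theorem hasDerivAt_dotProduct {ι : Type*} [Fintype ι] {x y : ℝ → ι → ℝ} {x' y' : ι → ℝ} {t : ℝ}
    (hx : HasDerivAt x x' t) (hy : HasDerivAt y y' t) :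
    HasDerivAt (fun s => x s ⬝ᵥ y s) (x' ⬝ᵥ y t + x t ⬝ᵥ y') t := by
  simp only [dotProduct, ← Finset.sum_add_distrib]
  exact HasDerivAt.fun_sum fun i _ => (hasDerivAt_pi.1 hx i).mul (hasDerivAt_pi.1 hy i)

variable {a b : ℝ} {v η w : ℝ → S.B → ℝ} {u δq τ : ℝ → Fin n → ℝ}

theorem _root_.ContinuousOn.dotProduct_pi {ι : Type*} [Fintype ι] {s : Set ℝ} {x y : ℝ → ι → ℝ}
    (hx : ContinuousOn x s) (hy : ContinuousOn y s) : ContinuousOn (fun t => x t ⬝ᵥ y t) s := by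
  simp only [dotProduct]
  exact continuousOn_finsetSum _ fun i _ =>
    (continuousOn_pi.1 hx i).mul (continuousOn_pi.1 hy i)

theorem continuousOn_residuals (hv : ContDiff ℝ 1 v) (hu : ContDiff ℝ 2 u)
    (hw : ContinuousOn w (Set.Icc a b)) (hτ : ContinuousOn τ (Set.Icc a b)) :
    ContinuousOn (fun t =>
      (S.base.ad (v t))ᵀ *ᵥ S.baseMomentum (v t) (S.proj (u t)) (deriv u t) + w t -
          deriv (fun s => S.baseMomentum (v s) (S.proj (u s)) (deriv u s)) t) (Set.Icc a b) ∧
    ContinuousOn (fun t =>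
      S.jointForce (v t) (S.proj (u t)) (deriv u t) + τ t -
          deriv (fun s => S.jointMomentum (v s) (S.proj (u s)) (deriv u s)) t) (Set.Icc a b) := by
  have hu1 : ContDiff ℝ 1 u := hu.of_le one_le_two
  have hu' : ContDiff ℝ 1 (deriv u) := ((contDiff_succ_iff_deriv (n := 1)).1 hu).2.2
  have hP := S.contDiff_baseMomentum hv hu1 hu'
  have hp := S.contDiff_jointMomentum hv hu1 hu'
  have hQ := S.contDiff_jointForce hv hu1 hu'
  have had : Continuous fun t =>
      (S.base.ad (v t))ᵀ *ᵥ S.baseMomentum (v t) (S.proj (u t)) (deriv u t) :=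
    (contDiff_pi.2 (contDiff_mulVec_apply (A := fun t => (S.base.ad (v t))ᵀ)
      (fun i j => S.base.contDiff_ad_apply hv j i) (contDiff_pi.1 hP))).continuous
  exact ⟨(had.continuousOn.add hw).sub hP.continuous_deriv_one.continuousOn,
    (hQ.continuous.continuousOn.add hτ).sub hp.continuous_deriv_one.continuousOn⟩

/-- Integration by parts in the first variation. -/
theorem integral_firstVariation_add (hab : a < b) (hv : ContDiff ℝ 1 v) (hu : ContDiff ℝ 2 u)
    (hη : ContDiff ℝ 1 η) (hδ : ContDiff ℝ 1 δq) (hw : ContinuousOn w (Set.Icc a b))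
    (hτ : ContinuousOn τ (Set.Icc a b)) (hηa : η a = 0) (hηb : η b = 0) (hδa : δq a = 0)
    (hδb : δq b = 0) :
    (∫ t in a..b, S.firstVariation v η u δq t) + ∫ t in a..b, (w t ⬝ᵥ η t + τ t ⬝ᵥ δq t) =
      ∫ t in a..b,
        (((S.base.ad (v t))ᵀ *ᵥ S.baseMomentum (v t) (S.proj (u t)) (deriv u t) + w t -
          deriv (fun s => S.baseMomentum (v s) (S.proj (u s)) (deriv u s)) t) ⬝ᵥ η t +
        (S.jointForce (v t) (S.proj (u t)) (deriv u t) + τ t -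
          deriv (fun s => S.jointMomentum (v s) (S.proj (u s)) (deriv u s)) t) ⬝ᵥ δq t) := by
  have hη' : Continuous (deriv η) := hη.continuous_deriv_one
  have hδ' : Continuous (deriv δq) := hδ.continuous_deriv_one
  have hu1 : ContDiff ℝ 1 u := hu.of_le one_le_two
  have hu' : ContDiff ℝ 1 (deriv u) := ((contDiff_succ_iff_deriv (n := 1)).1 hu).2.2
  have hP := S.contDiff_baseMomentum hv hu1 hu'
  have hp := S.contDiff_jointMomentum hv hu1 hu'
  obtain ⟨h1, h2⟩ := S.continuousOn_residuals hv hu hw hτ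
  have hI : ∀ {f : ℝ → ℝ}, ContinuousOn f (Set.Icc a b) →
      IntervalIntegrable f MeasureTheory.volume a b := fun hf =>
    hf.intervalIntegrable_of_Icc hab.le
  have hfV : Continuous (S.firstVariation v η u δq) :=
    (((S.contDiff_lagrangianLift (r := 1)).continuous_fderiv one_ne_zero).comp
      (hv.continuous.prodMk (hu.continuous.prodMk hu'.continuous))).clm_apply
      ((hη'.add (S.base.contDiff_ad_mulVec hv hη).continuous).prodMk
        (hδ.continuous.prodMk hδ'))
  have hηc := hη.continuous.continuousOn (s := Set.Icc a b)
  have hδc := hδ.continuous.continuousOn (s := Set.Icc a b)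
  -- the boundary terms are the values of `⟨p, η⟩ + ⟨π, δq⟩`
  have hder : ∀ t, HasDerivAt (fun s =>
      S.baseMomentum (v s) (S.proj (u s)) (deriv u s) ⬝ᵥ η s +
        S.jointMomentum (v s) (S.proj (u s)) (deriv u s) ⬝ᵥ δq s) _ t := fun t =>
    (hasDerivAt_dotProduct (hP.differentiable one_ne_zero t).hasDerivAt
      (hη.differentiable one_ne_zero t).hasDerivAt).add
    (hasDerivAt_dotProduct (hp.differentiable one_ne_zero t).hasDerivAt
      (hδ.differentiable one_ne_zero t).hasDerivAt)
  have hcont := ((hP.continuous_deriv_one.continuousOn.dotProduct_pi hηc).add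
    (hP.continuous.continuousOn.dotProduct_pi hη'.continuousOn)).add
    ((hp.continuous_deriv_one.continuousOn.dotProduct_pi hδc).add
      (hp.continuous.continuousOn.dotProduct_pi (hδ'.continuousOn (s := Set.Icc a b))))
  have hFTC := intervalIntegral.integral_eq_sub_of_hasDerivAt (fun t _ => hder t) (hI hcont)
  simp only [hηa, hηb, hδa, hδb, dotProduct_zero, add_zero, sub_zero] at hFTC
  have hWI : IntervalIntegrable (fun t => w t ⬝ᵥ η t + τ t ⬝ᵥ δq t) MeasureTheory.volume a b :=
    hI ((hw.dotProduct_pi hηc).add (hτ.dotProduct_pi hδc))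
  have hRI : IntervalIntegrable (fun t =>
      ((S.base.ad (v t))ᵀ *ᵥ S.baseMomentum (v t) (S.proj (u t)) (deriv u t) + w t -
        deriv (fun s => S.baseMomentum (v s) (S.proj (u s)) (deriv u s)) t) ⬝ᵥ η t +
      (S.jointForce (v t) (S.proj (u t)) (deriv u t) + τ t -
        deriv (fun s => S.jointMomentum (v s) (S.proj (u s)) (deriv u s)) t) ⬝ᵥ δq t)
      MeasureTheory.volume a b :=
    hI ((h1.dotProduct_pi hηc).add (h2.dotProduct_pi hδc))
  rw [← intervalIntegral.integral_add (hfV.intervalIntegrable _ _) hWI, ← sub_eq_zero,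
    ← intervalIntegral.integral_sub ((hfV.intervalIntegrable _ _).add hWI) hRI, ← hFTC]
  refine intervalIntegral.integral_congr fun t _ => ?_
  have had : S.baseMomentum (v t) (S.proj (u t)) (deriv u t) ⬝ᵥ (S.base.ad (v t) *ᵥ η t) =
      ((S.base.ad (v t))ᵀ *ᵥ S.baseMomentum (v t) (S.proj (u t)) (deriv u t)) ⬝ᵥ η t := by
    rw [dotProduct_comm _ (η t), dotProduct_transpose_mulVec, dotProduct_comm]
  simp only [firstVariation, fderiv_lagrangianLift, dotProduct_add, add_dotProduct,
    sub_dotProduct, had]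
  ring

theorem EulerLagrange.integral_firstVariation (hEL : S.EulerLagrange a b v u w τ)
    (hab : a < b) (hv : ContDiff ℝ 1 v) (hu : ContDiff ℝ 2 u)
    (hη : ContDiff ℝ 1 η) (hδ : ContDiff ℝ 1 δq) (hw : ContinuousOn w (Set.Icc a b))
    (hτ : ContinuousOn τ (Set.Icc a b)) (hηa : η a = 0) (hηb : η b = 0) (hδa : δq a = 0)
    (hδb : δq b = 0) :
    ∫ t in a..b, S.firstVariation v η u δq t = -∫ t in a..b, (w t ⬝ᵥ η t + τ t ⬝ᵥ δq t) := by
  rw [eq_neg_iff_add_eq_zero,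
    S.integral_firstVariation_add hab hv hu hη hδ hw hτ hηa hηb hδa hδb,
    intervalIntegral.integral_congr (g := fun _ => 0), intervalIntegral.integral_zero]
  intro t ht
  rw [Set.uIcc_of_le hab.le] at ht
  simp only [sub_eq_zero.2 (hEL t ht).1, sub_eq_zero.2 (hEL t ht).2, zero_dotProduct, add_zero]

/-- By the fundamental lemma of the calculus of variations, variations of one component at a time
of the base motion suffice for the Euler–Lagrange equations. -/
theorem eulerLagrange_of_integral_firstVariation (hab : a < b) (hv : ContDiff ℝ 1 v)
    (hu : ContDiff ℝ 2 u) (hw : ContinuousOn w (Set.Icc a b)) (hτ : ContinuousOn τ (Set.Icc a b))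
    (hvar : ∀ (i : S.B) (φ : ℝ → ℝ) (δq : ℝ → Fin n → ℝ), ContDiff ℝ 2 φ → ContDiff ℝ 2 δq →
      φ a = 0 → φ b = 0 → δq a = 0 → δq b = 0 →
      ∫ t in a..b, S.firstVariation v (fun t => φ t • Pi.single i 1) u δq t =
        -∫ t in a..b, (w t ⬝ᵥ (φ t • Pi.single i 1) + τ t ⬝ᵥ δq t)) :
    S.EulerLagrange a b v u w τ := by
  obtain ⟨h1, h2⟩ := S.continuousOn_residuals hv hu hw hτ
  have hne : Nonempty S.B := by
    change Nonempty S.base.Idx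
    cases S.base
    · exact ⟨(Sum.inl 0 : Six)⟩
    · exact ⟨(0 : Fin 3)⟩
  have key : ∀ (i : S.B) (φ : ℝ → ℝ) (δq : ℝ → Fin n → ℝ), ContDiff ℝ 2 φ → ContDiff ℝ 2 δq →
      φ a = 0 → φ b = 0 → δq a = 0 → δq b = 0 → _ := fun i φ δq hφ hδ hφa hφb hδa hδb =>
    (S.integral_firstVariation_add (η := fun t => φ t • Pi.single i 1) hab hv hu
      ((hφ.of_le one_le_two).smul contDiff_const) (hδ.of_le one_le_two) hw hτ
      (by simp [hφa]) (by simp [hφb]) hδa hδb).symm.trans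
      (eq_neg_iff_add_eq_zero.1 (hvar i φ δq hφ hδ hφa hφb hδa hδb))
  intro t ht
  constructor
  · rw [← sub_eq_zero]
    ext i
    refine eqOn_zero_of_integral_mul_eq_zero hab (continuousOn_pi.1 h1 i)
      (fun φ hφ hφa hφb => ?_) t ht
    have := key i φ 0 hφ contDiff_const hφa hφb rfl rfl
    simpa [mul_comm] using this
  · rw [← sub_eq_zero]
    ext i
    refine eqOn_zero_of_integral_mul_eq_zero hab (continuousOn_pi.1 h2 i)
      (fun φ hφ hφa hφb => ?_) t ht
    -- the base is not varied here, so that any index serves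
    have := key hne.some 0 (fun t => φ t • Pi.single i 1) contDiff_const
      (hφ.smul contDiff_const) rfl rfl (by simp [hφa]) (by simp [hφb])
    simpa [mul_comm] using this

end VMS

namespace VMS

variable {n : ℕ} (S : VMS n) {a b : ℝ} {h : ℝ → Matrix Hom Hom ℝ} {v w p : ℝ → S.B → ℝ}
  {u τ π : ℝ → Fin n → ℝ}

/-! ### The two variational principles -/

theorem reducedLagrangeDAlembert_iff (hab : a < b) (hv : ContDiff ℝ 1 v) (hu : ContDiff ℝ 2 u)
    (hw : ContinuousOn w (Set.Icc a b)) (hτ : ContinuousOn τ (Set.Icc a b)) :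
    S.ReducedLagrangeDAlembert a b v u w τ ↔ S.EulerLagrange a b v u w τ := by
  constructor
  · intro hR
    refine S.eulerLagrange_of_integral_firstVariation hab hv hu hw hτ
      fun i φ δq hφ hδ hφa hφb hδa hδb => ?_
    have hη : ContDiff ℝ 1 fun t => φ t • (Pi.single i 1 : S.B → ℝ) :=
      (hφ.of_le one_le_two).smul contDiff_const
    have hδ1 : ContDiff ℝ 1 δq := hδ.of_le one_le_two
    exact (S.hasDerivAt_reducedAction hv hu hη hδ1 a b).unique
      (hR _ δq hη hδ1 (by simp [hφa]) (by simp [hφb]) hδa hδb)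
  · intro hEL η δq hη hδ hηa hηb hδa hδb
    rw [← hEL.integral_firstVariation S hab hv hu hη hδ hw hτ hηa hηb hδa hδb]
    exact S.hasDerivAt_reducedAction hv hu hη hδ a b

/-- The variation field `η = h⁻¹ δh` of the family `h(t) g(ε φ(t))` is `φ` times the velocity of
`g` at the identity. -/
theorem bodyVelocity_mul_curve (k : BaseKind) {H : Matrix Hom Hom ℝ} (hH : H ∈ k.group)
    {g : ℝ → Matrix Hom Hom ℝ} {e : k.Idx → ℝ}
    (hg : ∀ a b, HasDerivAt (fun s => g s a b) (hat (k.incl *ᵥ e) a b) 0) (c : ℝ) :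
    k.bodyVelocity H (matDeriv (fun ε => H * g (ε * c)) 0) = c • e := by
  have h1 : ∀ a b, HasDerivAt (fun ε => g (ε * c) a b) ((c • hat (k.incl *ᵥ e)) a b) 0 :=
    fun a b => by
      have h2 : HasDerivAt (fun ε : ℝ => ε * c) c 0 := by
        simpa using (hasDerivAt_id (0 : ℝ)).mul_const c
      have h3 := hg a b
      rw [← zero_mul c] at h3
      exact (h3.comp (h := fun ε : ℝ => ε * c) 0 h2).congr_deriv (mul_comm _ _)
  have h4 : matDeriv (fun ε => H * g (ε * c)) 0 = H * (c • hat (k.incl *ᵥ e)) := by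
    ext a b
    have := hasDerivAt_mul_apply (A := fun _ => H) (A' := 0)
      (fun i j => hasDerivAt_const (0 : ℝ) (H i j)) h1 a b
    simpa [matDeriv] using this.deriv
  rw [BaseKind.bodyVelocity, h4, Matrix.nonsing_inv_mul_cancel_left _ _
    (isUnit_det_of_mem_SE3 (k.group_subset_SE3 hH)), vee_smul, vee_hat, Matrix.mulVec_smul,
    k.incl_transpose_mulVec_incl]

theorem lagrangeDAlembert_iff (hab : a < b) (hm : S.IsMotion h u)
    (hw : ContinuousOn w (Set.Icc a b)) (hτ : ContinuousOn τ (Set.Icc a b)) :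
    S.LagrangeDAlembert a b h u w τ ↔ S.EulerLagrange a b (S.baseTwist h) u w τ := by
  have hv := S.contDiff_baseTwist hm
  have hu := hm.contDiff_joint
  constructor
  · intro hL
    refine S.eulerLagrange_of_integral_firstVariation hab hv hu hw hτ
      fun i φ δq hφ hδ hφa hφb hδa hδb => ?_
    obtain ⟨g, hg, hgc, hg0, hgd⟩ := S.base.exists_curve i
    -- right translation by a curve through the identity of `G_b` keeps the family in `G_b`
    let hf : ℝ → ℝ → Matrix Hom Hom ℝ := fun ε t => h t * g (ε * φ t)
    let uf : ℝ → ℝ → Fin n → ℝ := fun ε t => u t + ε • δq t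
    have hmem : ∀ ε t, hf ε t ∈ S.base.group := fun ε t => S.base.mul_mem_group (hm.mem t) (hg _)
    have hc : ∀ i j, ContDiff ℝ 2 fun z : ℝ × ℝ => hf z.1 z.2 i j :=
      contDiff_mul_apply (fun i j => (hm.contDiff_base i j).comp contDiff_snd)
        fun i j => (hgc i j).comp (contDiff_fst.mul (hφ.comp contDiff_snd))
    have huc : ContDiff ℝ 2 fun z : ℝ × ℝ => uf z.1 z.2 :=
      (hu.comp contDiff_snd).add (contDiff_fst.smul (hδ.comp contDiff_snd))
    have h0 : ∀ t, hf 0 t = h t ∧ uf 0 t = u t := fun t => by simp [hf, uf, hg0]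
    have hη : ∀ t, S.base.bodyVelocity (h t) (matDeriv (fun ε => hf ε t) 0) =
        φ t • Pi.single i 1 := fun t => bodyVelocity_mul_curve S.base (hm.mem t) hgd (φ t)
    have hδ' : ∀ t, deriv (fun ε => uf ε t) 0 = δq t := fun t =>
      ((((hasDerivAt_id (0 : ℝ)).smul_const (δq t)).const_add (u t)).deriv).trans (one_smul _ _)
    have := (S.hasDerivAt_fullAction hmem hc huc h0 a b).unique
      (hL hf uf hmem hc huc h0 fun ε => by simp [hf, uf, hφa, hφb, hδa, hδb, hg0])
    simpa only [hη, hδ'] using this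
  · intro hEL hf uf hmem hc huc h0 hend
    have hη : ContDiff ℝ 1 fun t => S.base.bodyVelocity (h t) (matDeriv (fun ε => hf ε t) 0) := by
      refine S.base.contDiff_bodyVelocity hm.mem
        (fun i j => (hm.contDiff_base i j).of_le one_le_two) fun i j => ?_
      exact (contDiff_deriv_left (m := 1) (hc i j) (by norm_num)).comp
        (contDiff_const.prodMk contDiff_id)
    have hδ : ContDiff ℝ 1 fun t => deriv (fun ε => uf ε t) 0 :=
      (contDiff_deriv_left (m := 1) huc (by norm_num)).comp (contDiff_const.prodMk contDiff_id)
    have hη0 : ∀ (H K : Matrix Hom Hom ℝ), S.base.bodyVelocity H (matDeriv (fun _ => K) 0) = 0 :=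
      fun H K => by
        have : matDeriv (fun _ => K) 0 = 0 := by
          ext i j
          simp [matDeriv]
        have h2 : vee 0 = 0 := by simpa using vee_smul 0 0
        rw [this, BaseKind.bodyVelocity, mul_zero, h2, Matrix.mulVec_zero]
    rw [← hEL.integral_firstVariation S hab hv hu hη hδ hw hτ
      (by simp only [fun ε => (hend ε).1, hη0]) (by simp only [fun ε => (hend ε).2.1, hη0])
      (by simp only [fun ε => (hend ε).2.2.1, deriv_const])
      (by simp only [fun ε => (hend ε).2.2.2, deriv_const])]
    exact S.hasDerivAt_fullAction hmem hc huc h0 a b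

/-! ### The port-Hamiltonian equations -/

theorem transpose_interconnection (p : S.B → ℝ) :
    (S.interconnection p)ᵀ = -S.interconnection p := by
  rw [interconnection, Matrix.fromBlocks_transpose, Matrix.fromBlocks_transpose,
    S.base.transpose_adTilde, Matrix.fromBlocks_neg, Matrix.fromBlocks_neg]
  simp

theorem interconnection_mulVec_add_input_mulVec (p x w : S.B → ℝ) (y z τ : Fin n → ℝ) :
    S.interconnection p *ᵥ Sum.elim x (Sum.elim y z) + S.input *ᵥ Sum.elim w τ =
      Sum.elim ((S.base.ad x)ᵀ *ᵥ p + w) (Sum.elim z (-y + τ)) := by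
  rw [interconnection, input, Matrix.fromBlocks_mulVec, Matrix.fromBlocks_mulVec]
  simp only [Sum.elim_comp_inl, Sum.elim_comp_inr, Matrix.fromBlocks_mulVec,
    Matrix.fromRows_mulVec, S.base.adTilde_mulVec]
  ext i
  rcases i with i | i | i <;> simp [Matrix.neg_mulVec]

theorem hasDerivWithinAt_sumElim {κ μ : Type*} [Fintype κ] [Fintype μ] {f : ℝ → κ → ℝ}
    {g : ℝ → μ → ℝ} {f' : κ → ℝ} {g' : μ → ℝ} {s : Set ℝ} {t : ℝ} :
    HasDerivWithinAt (fun x => Sum.elim (f x) (g x)) (Sum.elim f' g') s t ↔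
      HasDerivWithinAt f f' s t ∧ HasDerivWithinAt g g' s t := by
  simp only [hasDerivWithinAt_pi, Sum.forall, Sum.elim_inl, Sum.elim_inr]

theorem hasDerivWithinAt_iff_of_eqOn {κ : Type*} [Fintype κ] {f g : ℝ → κ → ℝ} {f' g' : κ → ℝ}
    {t : ℝ} (hab : a < b) (ht : t ∈ Set.Icc a b) (hfg : Set.EqOn f g (Set.Icc a b))
    (hg : HasDerivWithinAt g g' (Set.Icc a b) t) :
    HasDerivWithinAt f f' (Set.Icc a b) t ↔ f' = g' := by
  have hf := hg.congr_of_mem hfg ht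
  exact ⟨fun hf' => (uniqueDiffOn_Icc hab t ht).eq_deriv _ hf' hf, fun h => h ▸ hf⟩

theorem eulerLagrange_and_areMomenta_iff (hab : a < b) (hm : S.IsMotion h u) :
    S.EulerLagrange a b (S.baseTwist h) u w τ ∧ S.AreMomenta a b h u p π ↔
      S.PortHamiltonian S.hamiltonian a b (S.baseTwist h) p u π w τ := by
  have hv := S.contDiff_baseTwist hm
  have hu := hm.contDiff_joint
  have hu1 : ContDiff ℝ 1 u := hu.of_le one_le_two
  have hu' : ContDiff ℝ 1 (deriv u) := ((contDiff_succ_iff_deriv (n := 1)).1 hu).2.2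
  have hP : ∀ t s, HasDerivWithinAt _ _ s t := fun t s =>
    ((S.contDiff_baseMomentum hv hu1 hu').differentiable one_ne_zero t).hasDerivAt.hasDerivWithinAt
  have hp : ∀ t s, HasDerivWithinAt _ _ s t := fun t s =>
    ((S.contDiff_jointMomentum hv hu1 hu').differentiable one_ne_zero t).hasDerivAt.hasDerivWithinAt
  have hud : ∀ t s, HasDerivWithinAt u _ s t := fun t s =>
    (hu1.differentiable one_ne_zero t).hasDerivAt.hasDerivWithinAt
  have hmom : S.AreMomenta a b h u p π ↔ ∀ t ∈ Set.Icc a b, Sum.elim (S.baseTwist h t) (deriv u t) =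
      S.inputᵀ *ᵥ S.grad S.hamiltonian (p t, S.proj (u t), π t) := by
    simp only [input_transpose_mulVec_grad_hamiltonian, ← momenta_eq_iff]
    rfl
  rw [PortHamiltonian, forall₂_and, ← hmom, and_congr_left_iff]
  intro hM
  refine forall₂_congr fun t ht => ?_
  have hpe : Set.EqOn p _ (Set.Icc a b) := fun s hs => (hM s hs).1
  have hπe : Set.EqOn π _ (Set.Icc a b) := fun s hs => (hM s hs).2
  rw [(hM t ht).1, (hM t ht).2, grad_hamiltonian, interconnection_mulVec_add_input_mulVec,
    neg_neg, hasDerivWithinAt_sumElim, hasDerivWithinAt_sumElim,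
    hasDerivWithinAt_iff_of_eqOn hab ht hpe (hP t _),
    hasDerivWithinAt_iff_of_eqOn hab ht hπe (hp t _), and_iff_right (hud t _)]

end VMS

end VehicleManipulator

theorem theorem1 {n : ℕ} (S : VehicleManipulator.VMS n) :
    -- the mass matrix is invertible, so that the Hamiltonian is well defined
    (∀ q : S.Qm, (S.mass q).PosDef) ∧
    -- the conjugate momenta
    (∀ (v : S.B → ℝ) (q : S.Qm) (q' : Fin n → ℝ),
      S.baseMomentum v q q' = S.massB q *ᵥ v + S.massBM q *ᵥ q' ∧
      S.jointMomentum v q q' = (S.massBM q)ᵀ *ᵥ v + S.massM q *ᵥ q') ∧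
    -- the Hamiltonian is the Legendre transform of the reduced Lagrangian, and it is smooth
    S.IsLegendreTransform S.hamiltonian ∧
    (ContDiff ℝ (⊤ : ℕ∞) fun y : (S.B → ℝ) × (Fin n → ℝ) × (Fin n → ℝ) =>
      S.hamiltonian (y.1, S.proj y.2.1, y.2.2)) ∧
    -- the interconnection matrix is skew-symmetric
    (∀ p : S.B → ℝ, (S.interconnection p)ᵀ = -S.interconnection p) ∧
    -- the equations of motion
    (∀ (a b : ℝ), a < b →
      ∀ (h : ℝ → Matrix VehicleManipulator.Hom VehicleManipulator.Hom ℝ) (u : ℝ → Fin n → ℝ), S.IsMotion h u →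
      ∀ (w : ℝ → S.B → ℝ) (τ : ℝ → Fin n → ℝ),
        ContinuousOn w (Set.Icc a b) → ContinuousOn τ (Set.Icc a b) →
      ∀ (p : ℝ → S.B → ℝ) (π : ℝ → Fin n → ℝ),
        List.TFAE [
          S.LagrangeDAlembert a b h u w τ ∧ S.AreMomenta a b h u p π,
          S.ReducedLagrangeDAlembert a b (S.baseTwist h) u w τ ∧ S.AreMomenta a b h u p π,
          S.PortHamiltonian S.hamiltonian a b (S.baseTwist h) p u π w τ]) := by
  refine ⟨S.posDef_mass, S.momenta_eq, S.isLegendreTransform_hamiltonian, S.contDiff_hamiltonian,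
    S.transpose_interconnection, fun a b hab h u hm w τ hw hτ p π => ?_⟩
  rw [S.lagrangeDAlembert_iff hab hm hw hτ,
    S.reducedLagrangeDAlembert_iff hab (S.contDiff_baseTwist hm) hm.contDiff_joint hw hτ,
    S.eulerLagrange_and_areMomenta_iff hab hm]
  tfae_finish
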